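/- For a finite group $G$ and a generating set $S \subseteq G$, let $\operatorname{diam}(G,S)$ be the least $n \in \mathbb{N}$ such that every element of $G$ is a product of at most $n$ elements of $S \cup S^{-1}$, and let $\operatorname{diam}(G)$ be the maximum of $\operatorname{diam}(G,S)$ over all generating sets $S$ of $G$. Let $\mathcal{T}_2$ be the binary rooted tree, whose vertices are the finite words over $\{0,1\}$, and let $\operatorname{Aut}(\mathcal{T}_2)$ be the group of permutations of the set of words that preserve the prefix order. The Grigorchuk $2$-group $\mathfrak{G}$ is the subgroup of $\operatorname{Aut}(\mathcal{T}_2)$ generated by the automorphisms $a,b,c,d$ that fix the empty word and satisfy, for all words $w$, $$a(0w)=1w,\quad a(1w)=0w,\quad b(0w)=0a(w),\quad b(1w)=1c(w),$$ $$c(0w)=0a(w),\quad c(1w)=1d(w),\quad d(0w)=0w,\quad d(1w)=1b(w).$$ Let $\operatorname{Stab}_{\mathfrak{G}}(n) \trianglelefteq \mathfrak{G}$ be the subgroup of those elements that fix every word of length $n$. **Theorem.** The groups $\mathfrak{G}/\operatorname{Stab}_{\mathfrak{G}}(n)$ ($n \geq 0$) are finite, and there is an absolute constant $C$ such that for all $n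 \ge 0$ $$\operatorname{diam}\big(\mathfrak{G}/\operatorname{Stab}_{\mathfrak{G}}(n)\big) \leq C \cdot 35^n .$$ Equivalently, there is an absolute constant $C'$ such that for all $n \geq 0$ $$\operatorname{diam}\big(\mathfrak{G}/\operatorname{Stab}_{\mathfrak{G}}(n)\big) \leq C' \big(\log |\mathfrak{G} : \operatorname{Stab}_{\mathfrak{G}}(n)|\big)^{\log 35/\log 2};$$ the two bounds are of the same order, that is, there are absolute constants $c_1, c_2 > 0$ such that for all $n \geq 1$ $$c_1 \cdot 35^n \leq \big(\log |\mathfrak{G} : \operatorname{Stab}_{\mathfrak{G}}(n)|\big)^{\log 35/\log 2} \leq c_2 \cdot 35^n .$$ -/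

import Mathlib

/-! ### Diameters of finite groups -/

/-- The closed ball of radius `n` about `1` in the word metric defined by `S`: the products of at
most `n` elements of `S ∪ S⁻¹`. -/
def wordBall {G : Type*} [Group G] (S : Set G) (n : ℕ) : Set G :=
  {g | ∃ l : List G, l.length ≤ n ∧ (∀ x ∈ l, x ∈ S ∨ x⁻¹ ∈ S) ∧ l.prod = g}

/-- `diam (G, S) = min {n : B_S(n) = G}`, for `S` a generating set of a finite group `G` (the
set of such `n` is then nonempty). -/
noncomputable def diamWrt {G : Type*} [Group G] (S : Set G) : ℕ :=
  sInf {n : ℕ | wordBall S n = Set.univ}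

/-- `diam G`, the maximum of `diam (G, S)` over all generating sets `S` of the finite group `G`
(there are finitely many such `S`, so this supremum is a maximum). -/
noncomputable def groupDiam (G : Type*) [Group G] : ℕ :=
  sSup {k : ℕ | ∃ S : Set G, Subgroup.closure S = ⊤ ∧ diamWrt S = k}

/-! ### Automorphisms of the regular rooted tree of words -/

/-- The automorphism group of the regular rooted tree with vertex set the words on `A`: the
permutations of the set of words that preserve the prefix relation `<+:`. -/
def TreeAut (A : Type*) : Subgroup (Equiv.Perm (List A)) where
  carrier := {f | ∀ u v : List A, f u <+: f v ↔ u <+: v}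
  one_mem' := fun _ _ => Iff.rfl
  mul_mem' := fun {f g} hf hg u v => (hf (g u) (g v)).trans (hg u v)
  inv_mem' := fun {f} hf u v => by
    have h := hf (f⁻¹ u) (f⁻¹ v)
    simpa using h.symm

/-- Tree automorphisms preserve the level sets. -/
theorem TreeAut.length_apply {A : Type*} (f : TreeAut A) (w : List A) :
    (f.1 w).length = w.length := by
  have aux : ∀ (g : TreeAut A) (v : List A), v.length ≤ (g.1 v).length := by
    intro g v
    induction v using List.reverseRecOn with
    | nil => simp
    | append_singleton v x ih =>
      have h1 : g.1 v <+: g.1 (v ++ [x]) := (g.2 _ _).2 (List.prefix_append _ _)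
      have h2 : g.1 v ≠ g.1 (v ++ [x]) := fun h => by
        have := congrArg List.length (g.1.injective h)
        simp at this
      have h3 : (g.1 v).length ≠ (g.1 (v ++ [x])).length := fun h => h2 (h1.eq_of_length h)
      have h4 := h1.length_le
      simp only [List.length_append, List.length_singleton]
      omega
  refine le_antisymm ?_ (aux f w)
  have h := aux f⁻¹ (f.1 w)
  simpa using h

/-- The `n`th level stabiliser `Stab(n)`: the tree automorphisms acting trivially on the set of
words of length `n`. -/
def levelStab (A : Type*) (n : ℕ) : Subgroup (TreeAut A) where
  carrier := {f | ∀ w : List A, w.length = n → f.1 w = w}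
  one_mem' := fun _ _ => rfl
  mul_mem' := fun {f g} hf hg w hw => by
    change f.1 (g.1 w) = w
    rw [hg w hw, hf w hw]
  inv_mem' := fun {f} hf w hw => by
    change f.1.symm w = w
    rw [Equiv.symm_apply_eq, hf w hw]

instance levelStab_normal (A : Type*) (n : ℕ) : (levelStab A n).Normal where
  conj_mem f hf g w hw := by
    change g.1 (f.1 (g⁻¹.1 w)) = w
    rw [hf (g⁻¹.1 w) (by rw [TreeAut.length_apply, hw])]
    change g.1 (g.1.symm w) = w
    simp

/-! ### The Grigorchuk group

The alphabet is `Bool`, with `false` for the letter `0` and `true` for the letter `1`. -/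

/-- `a(0w) = 1w`, `a(1w) = 0w`. -/
def grigA : List Bool → List Bool
  | [] => []
  | false :: w => true :: w
  | true :: w => false :: w

mutual

/-- `b(0w) = 0a(w)`, `b(1w) = 1c(w)`. -/
def grigB : List Bool → List Bool
  | [] => []
  | false :: w => false :: grigA w
  | true :: w => true :: grigC w

/-- `c(0w) = 0a(w)`, `c(1w) = 1d(w)`. -/
def grigC : List Bool → List Bool
  | [] => []
  | false :: w => false :: grigA w
  | true :: w => true :: grigD w

/-- `d(0w) = 0w`, `d(1w) = 1b(w)`. -/
def grigD : List Bool → List Bool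
  | [] => []
  | false :: w => false :: w
  | true :: w => true :: grigB w

end

theorem grigA_grigA (w : List Bool) : grigA (grigA w) = w := by
  rcases w with _ | ⟨_ | _, w⟩ <;> rfl

theorem grigBCD_involutive (w : List Bool) :
    grigB (grigB w) = w ∧ grigC (grigC w) = w ∧ grigD (grigD w) = w := by
  induction w with
  | nil => simp [grigB, grigC, grigD]
  | cons x w ih => cases x <;> simp [grigB, grigC, grigD, grigA_grigA, ih]

theorem grigA_prefix (u v : List Bool) : grigA u <+: grigA v ↔ u <+: v := by
  rcases u with _ | ⟨_ | _, u⟩ <;> rcases v with _ | ⟨_ | _, v⟩ <;>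
    simp [grigA, List.cons_prefix_cons]

theorem grigBCD_prefix (u : List Bool) : ∀ v : List Bool,
    (grigB u <+: grigB v ↔ u <+: v) ∧ (grigC u <+: grigC v ↔ u <+: v) ∧
      (grigD u <+: grigD v ↔ u <+: v) := by
  induction u with
  | nil => intro v; simp [grigB, grigC, grigD]
  | cons x u ih =>
    intro v
    rcases v with _ | ⟨_ | _, v⟩ <;> cases x <;>
      simp [grigB, grigC, grigD, List.cons_prefix_cons, grigA_prefix, ih]

/-- The automorphism `a` of the binary rooted tree. -/
def autA : TreeAut Bool :=
  ⟨⟨grigA, grigA, grigA_grigA, grigA_grigA⟩, grigA_prefix⟩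

/-- The automorphism `b` of the binary rooted tree. -/
def autB : TreeAut Bool :=
  ⟨⟨grigB, grigB, fun w => (grigBCD_involutive w).1, fun w => (grigBCD_involutive w).1⟩,
    fun u v => (grigBCD_prefix u v).1⟩

/-- The automorphism `c` of the binary rooted tree. -/
def autC : TreeAut Bool :=
  ⟨⟨grigC, grigC, fun w => (grigBCD_involutive w).2.1, fun w => (grigBCD_involutive w).2.1⟩,
    fun u v => (grigBCD_prefix u v).2.1⟩

/-- The automorphism `d` of the binary rooted tree. -/
def autD : TreeAut Bool :=
  ⟨⟨grigD, grigD, fun w => (grigBCD_involutive w).2.2, fun w => (grigBCD_involutive w).2.2⟩,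
    fun u v => (grigBCD_prefix u v).2.2⟩

/-- The Grigorchuk `2`-group. -/
def Grigorchuk : Subgroup (TreeAut Bool) :=
  Subgroup.closure {autA, autB, autC, autD}

/-- The `n`th level stabiliser of the Grigorchuk group, as a subgroup of it: its intersection
with `Stab(n)`. -/
def grigStab (n : ℕ) : Subgroup Grigorchuk :=
  (levelStab Bool n).subgroupOf Grigorchuk

instance grigStab_normal (n : ℕ) : (grigStab n).Normal :=
  Subgroup.normal_subgroupOf

-- The bound comes from a Solovay–Kitaev type procedure: elements deep in the tree are approximated
-- by commutators of elements from the two preceding levels.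
--
-- Let `K` be the normal closure of `x = (ab)²`. Pairs of elements of `K` lie in `K` again
-- (`pairSubgroup_branchK_le`), so `K_m = pairSet^[m] branchK` is a decreasing chain with `K_m ≤
-- Stab(m)`. It suffices to bound the length `ℓ_m` of words that reach every element of `K_m` up to
-- an error in `K_{m+1}` (`Covers`).
--
-- The quotient `K/K₁` is cyclic, generated by `x`, of order dividing `4`. So elements of `K₁` have
-- classes `(i, j)` modulo `4` over `K₂`, to be read as Gaussian integers `i + j√-1`. Conjugation by
-- `t = ca` multiplies classes by `√-1`, hence `⁅·, t⁆` multiplies them by `1 - √-1` and descends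
-- one step in the chain of ideals `(1), (1+√-1), (2), (2+2√-1), (4)` (`branchChain`); `⁅x, t⁆`
-- starts the descent from `K`. An error from `K` in `t` is harmless because `K' ≤ K₂`
-- (`commutator_mem_branchK₂`), and an error in the other entry only moves the result one step
-- further down the chain. The element `t` itself need not be in `K`, but `x = (t, t⁻¹)` is; so one
-- level lower the commutators are taken with `x`, which is known up to `K₁`.
--
-- Four such commutators give `ℓ_{m+2} ≤ 30 ℓ_{m+1} + 52 ℓ_m` (`covers_step`), and `30·35 + 52 ≤
-- 35²` yields `ℓ_m ≤ L·35^m`. Here `L` is the index of `K₂`, independent of `n` and of the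
-- generating set.
--
-- For the comparison with the index, self-similarity from above and `K × K ≤ K` from below give
-- `2ⁿ⁻² log 2 ≤ log |G : Stab(n)| ≤ 2ⁿ log 2` for `n ≥ 1`.

open scoped commutatorElement

/-! ### Pairs of tree automorphisms -/

/-- The automorphism of the binary tree fixing both children of the root, and acting as `u` on the
subtree below `0` and as `v` on the subtree below `1`. -/
def pairAut (u v : TreeAut Bool) : TreeAut Bool :=
  ⟨{ toFun := fun
        | [] => []
        | false :: w => false :: u.1 w
        | true :: w => true :: v.1 w
     invFun := fun
        | [] => []
        | false :: w => false :: u.1.symm w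
        | true :: w => true :: v.1.symm w
     left_inv := by rintro (_ | ⟨_ | _, w⟩) <;> simp
     right_inv := by rintro (_ | ⟨_ | _, w⟩) <;> simp },
    by
      have hu := u.2
      have hv := v.2
      rintro (_ | ⟨_ | _, w⟩) (_ | ⟨_ | _, w'⟩) <;> simp [List.cons_prefix_cons]
      · exact hu w w'
      · exact hv w w'⟩

@[simp] theorem pairAut_apply_nil (u v : TreeAut Bool) : (pairAut u v).1 [] = [] := rfl

@[simp] theorem pairAut_apply_false (u v : TreeAut Bool) (w : List Bool) :
    (pairAut u v).1 (false :: w) = false :: u.1 w := rfl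

@[simp] theorem pairAut_apply_true (u v : TreeAut Bool) (w : List Bool) :
    (pairAut u v).1 (true :: w) = true :: v.1 w := rfl

theorem TreeAut.ext_apply {f g : TreeAut Bool} (h : ∀ w, f.1 w = g.1 w) : f = g :=
  Subtype.ext (Equiv.ext h)

theorem pairAut_mul (u v u' v' : TreeAut Bool) :
    pairAut u v * pairAut u' v' = pairAut (u * u') (v * v') := by
  apply TreeAut.ext_apply
  rintro (_ | ⟨_ | _, w⟩) <;> rfl

theorem pairAut_one : pairAut 1 1 = 1 := by
  apply TreeAut.ext_apply
  rintro (_ | ⟨_ | _, w⟩) <;> rfl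

theorem pairAut_inv (u v : TreeAut Bool) : (pairAut u v)⁻¹ = pairAut u⁻¹ v⁻¹ := by
  rw [inv_eq_iff_mul_eq_one, pairAut_mul, mul_inv_cancel, mul_inv_cancel, pairAut_one]

theorem pairAut_injective {u v u' v' : TreeAut Bool} (h : pairAut u v = pairAut u' v') :
    u = u' ∧ v = v' := by
  have key : ∀ w, (pairAut u v).1 w = (pairAut u' v').1 w := fun w => by rw [h]
  constructor <;> apply TreeAut.ext_apply <;> intro w
  · simpa using key (false :: w)
  · simpa using key (true :: w)

theorem pairAut_commutator (u v u' v' : TreeAut Bool) :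
    ⁅pairAut u v, pairAut u' v'⁆ = pairAut ⁅u, u'⁆ ⁅v, v'⁆ := by
  simp only [commutatorElement_def, pairAut_inv, pairAut_mul]

theorem pairAut_mem_levelStab_succ {u v : TreeAut Bool} {n : ℕ} :
    pairAut u v ∈ levelStab Bool (n + 1) ↔ u ∈ levelStab Bool n ∧ v ∈ levelStab Bool n := by
  constructor
  · intro h
    constructor <;> intro w hw
    · simpa using h (false :: w) (by simp [hw])
    · simpa using h (true :: w) (by simp [hw])
  · rintro ⟨hu, hv⟩ (_ | ⟨_ | _, w⟩) hw
    · rfl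
    · simpa using hu w (by simpa using hw)
    · simpa using hv w (by simpa using hw)

theorem levelStab_zero : levelStab Bool 0 = ⊤ := by
  refine top_unique fun f _ w hw => ?_
  have h := TreeAut.length_apply f w
  rw [hw] at h
  rw [List.length_eq_zero_iff.1 h, List.length_eq_zero_iff.1 hw]

-- Relations between the generators, and their decompositions as pairs

theorem autA_mul_self : autA * autA = 1 :=
  TreeAut.ext_apply fun w => grigA_grigA w

theorem autB_mul_self : autB * autB = 1 :=
  TreeAut.ext_apply fun w => (grigBCD_involutive w).1

theorem autC_mul_self : autC * autC = 1 :=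
  TreeAut.ext_apply fun w => (grigBCD_involutive w).2.1

theorem autD_mul_self : autD * autD = 1 :=
  TreeAut.ext_apply fun w => (grigBCD_involutive w).2.2

theorem autA_inv : autA⁻¹ = autA := inv_eq_of_mul_eq_one_left autA_mul_self

theorem autB_inv : autB⁻¹ = autB := inv_eq_of_mul_eq_one_left autB_mul_self

theorem autC_inv : autC⁻¹ = autC := inv_eq_of_mul_eq_one_left autC_mul_self

theorem autD_inv : autD⁻¹ = autD := inv_eq_of_mul_eq_one_left autD_mul_self

theorem autB_eq_pairAut : autB = pairAut autA autC := by
  apply TreeAut.ext_apply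
  rintro (_ | ⟨_ | _, w⟩) <;> simp [autB, autA, autC, grigB]

theorem autC_eq_pairAut : autC = pairAut autA autD := by
  apply TreeAut.ext_apply
  rintro (_ | ⟨_ | _, w⟩) <;> simp [autC, autA, autD, grigC]

theorem autD_eq_pairAut : autD = pairAut 1 autB := by
  apply TreeAut.ext_apply
  rintro (_ | ⟨_ | _, w⟩) <;> simp [autD, autB, grigD]

theorem grigB_grigC (w : List Bool) : grigB (grigC w) = grigD w ∧ grigC (grigD w) = grigB w ∧
    grigD (grigB w) = grigC w := by
  induction w with
  | nil => simp [grigB, grigC, grigD]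
  | cons s w ih => cases s <;> simp [grigB, grigC, grigD, grigA_grigA, ih]

theorem autB_mul_autC : autB * autC = autD := TreeAut.ext_apply fun w => (grigB_grigC w).1

theorem autC_mul_autD : autC * autD = autB := TreeAut.ext_apply fun w => (grigB_grigC w).2.1

theorem autD_mul_autB : autD * autB = autC := TreeAut.ext_apply fun w => (grigB_grigC w).2.2

theorem autB_mul_autD : autB * autD = autC := by
  rw [← autC_mul_autD, mul_assoc, autD_mul_self, mul_one]

theorem autD_mul_autC : autD * autC = autB := by
  rw [← autB_mul_autC, mul_assoc, autC_mul_self, mul_one]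

theorem autC_mul_autB : autC * autB = autD := by
  rw [← autD_mul_autB, mul_assoc, autB_mul_self, mul_one]

theorem autA_conj_pairAut (u v : TreeAut Bool) : autA * pairAut u v * autA = pairAut v u := by
  apply TreeAut.ext_apply
  rintro (_ | ⟨_ | _, w⟩) <;> rfl

theorem autA_mul_pairAut (u v : TreeAut Bool) : autA * pairAut u v = pairAut v u * autA := by
  rw [← autA_conj_pairAut u v, mul_assoc, autA_mul_self, mul_one]

theorem autA_mem_Grigorchuk : autA ∈ Grigorchuk := Subgroup.subset_closure (by simp)

theorem autB_mem_Grigorchuk : autB ∈ Grigorchuk := Subgroup.subset_closure (by simp)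

theorem autC_mem_Grigorchuk : autC ∈ Grigorchuk := Subgroup.subset_closure (by simp)

theorem autD_mem_Grigorchuk : autD ∈ Grigorchuk := Subgroup.subset_closure (by simp)

/-- A subgroup stable under conjugation by `a`, `b` and `d` is normalised by the Grigorchuk
group. -/
theorem Grigorchuk_le_normalizer {H : Subgroup (TreeAut Bool)}
    (ha : ∀ h ∈ H, autA * h * autA ∈ H) (hb : ∀ h ∈ H, autB * h * autB ∈ H)
    (hd : ∀ h ∈ H, autD * h * autD ∈ H) {g : TreeAut Bool} (hg : g ∈ Grigorchuk)
    {h : TreeAut Bool} (hh : h ∈ H) : g * h * g⁻¹ ∈ H := by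
  -- Since `c = bd`, invariance under `c` comes for free.
  have hc : ∀ h ∈ H, autC * h * autC ∈ H := fun h hh => by
    have := hb _ (hd h hh)
    have e : autB * (autD * h * autD) * autB = (autB * autD) * h * (autD * autB) := by group
    rwa [e, autB_mul_autD, autD_mul_autB] at this
  unfold Grigorchuk at hg
  induction hg using Subgroup.closure_induction_left generalizing h with
  | one => simpa
  | mul_left s hs g hg ih =>
    have e : s * g * h * (s * g)⁻¹ = s * (g * h * g⁻¹) * s⁻¹ := by group
    rw [e]
    rcases hs with rfl | rfl | rfl | rfl
    · rw [autA_inv]; exact ha _ (ih hh)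
    · rw [autB_inv]; exact hb _ (ih hh)
    · rw [autC_inv]; exact hc _ (ih hh)
    · rw [autD_inv]; exact hd _ (ih hh)
  | inv_mul_cancel s hs g hg ih =>
    have e : s⁻¹ * g * h * (s⁻¹ * g)⁻¹ = s⁻¹ * (g * h * g⁻¹) * s := by group
    rw [e]
    rcases hs with rfl | rfl | rfl | rfl
    · rw [autA_inv]; exact ha _ (ih hh)
    · rw [autB_inv]; exact hb _ (ih hh)
    · rw [autC_inv]; exact hc _ (ih hh)
    · rw [autD_inv]; exact hd _ (ih hh)

/-- Every element of the Grigorchuk group is, up to `a` on the left, a pair. -/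
theorem exists_pairAut_of_mem_Grigorchuk {g : TreeAut Bool} (hg : g ∈ Grigorchuk) :
    ∃ u ∈ Grigorchuk, ∃ v ∈ Grigorchuk, g = pairAut u v ∨ g = autA * pairAut u v := by
  have hA := autA_mem_Grigorchuk
  have hB := autB_mem_Grigorchuk
  have hC := autC_mem_Grigorchuk
  have hD := autD_mem_Grigorchuk
  have pair : ∀ p ∈ Grigorchuk, ∀ q ∈ Grigorchuk, ∀ g,
      (∃ u ∈ Grigorchuk, ∃ v ∈ Grigorchuk, g = pairAut u v ∨ g = autA * pairAut u v) →
      ∃ u ∈ Grigorchuk, ∃ v ∈ Grigorchuk,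
        pairAut p q * g = pairAut u v ∨ pairAut p q * g = autA * pairAut u v := by
    rintro p hp q hq g ⟨u, hu, v, hv, rfl | rfl⟩
    · exact ⟨_, mul_mem hp hu, _, mul_mem hq hv, Or.inl (pairAut_mul ..)⟩
    · refine ⟨_, mul_mem hq hu, _, mul_mem hp hv, Or.inr ?_⟩
      rw [← pairAut_mul, ← mul_assoc, ← mul_assoc, autA_mul_pairAut]
  have gen : ∀ s ∈ ({autA, autB, autC, autD} : Set (TreeAut Bool)), ∀ g,
      (∃ u ∈ Grigorchuk, ∃ v ∈ Grigorchuk, g = pairAut u v ∨ g = autA * pairAut u v) →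
      ∃ u ∈ Grigorchuk, ∃ v ∈ Grigorchuk, s * g = pairAut u v ∨ s * g = autA * pairAut u v := by
    rintro s (rfl | rfl | rfl | rfl) g hg
    · obtain ⟨u, hu, v, hv, rfl | rfl⟩ := hg
      · exact ⟨u, hu, v, hv, Or.inr rfl⟩
      · exact ⟨u, hu, v, hv, Or.inl (by rw [← mul_assoc, autA_mul_self, one_mul])⟩
    · rw [autB_eq_pairAut]; exact pair _ hA _ hC g hg
    · rw [autC_eq_pairAut]; exact pair _ hA _ hD g hg
    · rw [autD_eq_pairAut]; exact pair _ (one_mem _) _ hB g hg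
  unfold Grigorchuk at hg
  induction hg using Subgroup.closure_induction_left with
  | one => exact ⟨1, one_mem _, 1, one_mem _, Or.inl pairAut_one.symm⟩
  | mul_left s hs g hg ih => exact gen s hs g ih
  | inv_mul_cancel s hs g hg ih =>
    have : s⁻¹ = s := by
      rcases hs with rfl | rfl | rfl | rfl
      exacts [autA_inv, autB_inv, autC_inv, autD_inv]
    rw [this]
    exact gen s hs g ih

/-! ### The branching subgroup -/

/-- The subgroup of the pairs with both entries in `H`. -/
def pairSubgroup (H : Subgroup (TreeAut Bool)) : Subgroup (TreeAut Bool) where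
  carrier := {p | ∃ u ∈ H, ∃ v ∈ H, p = pairAut u v}
  one_mem' := ⟨1, one_mem _, 1, one_mem _, pairAut_one.symm⟩
  mul_mem' := by
    rintro _ _ ⟨u, hu, v, hv, rfl⟩ ⟨u', hu', v', hv', rfl⟩
    exact ⟨_, mul_mem hu hu', _, mul_mem hv hv', pairAut_mul ..⟩
  inv_mem' := by
    rintro _ ⟨u, hu, v, hv, rfl⟩
    exact ⟨_, inv_mem hu, _, inv_mem hv, pairAut_inv ..⟩

theorem pairAut_mem_pairSubgroup {H : Subgroup (TreeAut Bool)} {u v : TreeAut Bool} (hu : u ∈ H)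
    (hv : v ∈ H) : pairAut u v ∈ pairSubgroup H := ⟨u, hu, v, hv, rfl⟩

theorem pairSubgroup_mono {H L : Subgroup (TreeAut Bool)} (h : H ≤ L) :
    pairSubgroup H ≤ pairSubgroup L := by
  rintro _ ⟨u, hu, v, hv, rfl⟩
  exact ⟨u, h hu, v, h hv, rfl⟩

theorem autB_conj_pairAut (u v : TreeAut Bool) :
    autB * pairAut u v * autB = pairAut (autA * u * autA) (autC * v * autC) := by
  simp only [autB_eq_pairAut, pairAut_mul]

theorem autC_conj_pairAut (u v : TreeAut Bool) :
    autC * pairAut u v * autC = pairAut (autA * u * autA) (autD * v * autD) := by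
  simp only [autC_eq_pairAut, pairAut_mul]

theorem autD_conj_pairAut (u v : TreeAut Bool) :
    autD * pairAut u v * autD = pairAut u (autB * v * autB) := by
  simp only [autD_eq_pairAut, pairAut_mul, one_mul, mul_one]

/-- A pair subgroup inherits invariance under conjugation by the Grigorchuk group. -/
theorem conj_mem_pairSubgroup {H : Subgroup (TreeAut Bool)}
    (hH : ∀ g ∈ Grigorchuk, ∀ h ∈ H, g * h * g⁻¹ ∈ H) :
    ∀ g ∈ Grigorchuk, ∀ h ∈ pairSubgroup H, g * h * g⁻¹ ∈ pairSubgroup H := by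
  have ha := fun h hh => autA_inv ▸ hH _ autA_mem_Grigorchuk h hh
  have hb := fun h hh => autB_inv ▸ hH _ autB_mem_Grigorchuk h hh
  have hc := fun h hh => autC_inv ▸ hH _ autC_mem_Grigorchuk h hh
  intro g hg h hh
  refine Grigorchuk_le_normalizer ?_ ?_ ?_ hg hh
  · rintro _ ⟨u, hu, v, hv, rfl⟩
    rw [autA_conj_pairAut]
    exact pairAut_mem_pairSubgroup hv hu
  · rintro _ ⟨u, hu, v, hv, rfl⟩
    rw [autB_conj_pairAut]
    exact pairAut_mem_pairSubgroup (ha _ hu) (hc _ hv)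
  · rintro _ ⟨u, hu, v, hv, rfl⟩
    rw [autD_conj_pairAut]
    exact pairAut_mem_pairSubgroup hu (hb _ hv)

-- The elements `x` and `t` and their commutators

/-- The element `x = (ab)²`. -/
def grigX : TreeAut Bool := autA * autB * autA * autB

/-- The element `t = ca`, the first entry of `x`. -/
def grigT : TreeAut Bool := autC * autA

theorem grigT_inv : grigT⁻¹ = autA * autC := by
  rw [grigT, mul_inv_rev, autA_inv, autC_inv]

theorem grigX_eq_pairAut : grigX = pairAut grigT grigT⁻¹ := by
  rw [grigX, autB_eq_pairAut, autA_mul_pairAut, mul_assoc (pairAut _ _), autA_mul_self, mul_one,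
    pairAut_mul, grigT_inv, grigT]

theorem grigX_mem_Grigorchuk : grigX ∈ Grigorchuk :=
  mul_mem (mul_mem (mul_mem autA_mem_Grigorchuk autB_mem_Grigorchuk) autA_mem_Grigorchuk)
    autB_mem_Grigorchuk

theorem grigT_mem_Grigorchuk : grigT ∈ Grigorchuk :=
  mul_mem autC_mem_Grigorchuk autA_mem_Grigorchuk

theorem autA_mul_autA_mul (g : TreeAut Bool) : autA * (autA * g) = g := by
  rw [← mul_assoc, autA_mul_self, one_mul]

theorem autB_mul_autB_mul (g : TreeAut Bool) : autB * (autB * g) = g := by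
  rw [← mul_assoc, autB_mul_self, one_mul]

theorem autC_mul_autC_mul (g : TreeAut Bool) : autC * (autC * g) = g := by
  rw [← mul_assoc, autC_mul_self, one_mul]

theorem autB_mul_autD_mul (g : TreeAut Bool) : autB * (autD * g) = autC * g := by
  rw [← mul_assoc, autB_mul_autD]

theorem autC_mul_autD_mul (g : TreeAut Bool) : autC * (autD * g) = autB * g := by
  rw [← mul_assoc, autC_mul_autD]

theorem autD_mul_autC_mul (g : TreeAut Bool) : autD * (autC * g) = autB * g := by
  rw [← mul_assoc, autD_mul_autC]

theorem grigX_inv : grigX⁻¹ = autB * autA * autB * autA := by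
  simp only [grigX, mul_inv_rev, autA_inv, autB_inv, mul_assoc]

theorem autA_conj_grigX : autA * grigX * autA = grigX⁻¹ := by
  rw [grigX_inv]
  simp only [grigX, mul_assoc, autA_mul_autA_mul]

theorem autB_conj_grigX : autB * grigX * autB = grigX⁻¹ := by
  rw [grigX_inv]
  simp only [grigX, mul_assoc, autB_mul_self, mul_one]

/-- The second factor will lie in `K × K`, so modulo that subgroup `d` centralises `x`, whereas `a`
and `b` invert it. -/
theorem autD_conj_grigX : autD * grigX * autD = grigX * pairAut 1 (autC * grigX * autC) := by
  rw [grigX_eq_pairAut, autD_conj_pairAut, pairAut_mul, mul_one, ← grigX_eq_pairAut]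
  congr 1
  simp only [grigX, grigT_inv, mul_assoc, autA_mul_autA_mul,
    autC_mul_autC_mul, autC_mul_autB, autB_mul_autC]

/-- This is the source of branching, as it puts `(1, x)` into the normal closure of `x`. It also
starts the descent from `K` into `K × K`. -/
theorem grigX_commutator_grigT : ⁅grigX, grigT⁆ = pairAut 1 grigX := by
  have h : ⁅grigX, grigT⁆ = grigX * (autC * (autA * grigX⁻¹ * autA) * autC) := by
    rw [commutatorElement_def, grigT_inv, grigT]
    simp only [mul_assoc]
  have h' : autA * grigX⁻¹ * autA = grigX := by
    rw [← autA_conj_grigX]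
    simp only [mul_assoc, autA_mul_self, autA_mul_autA_mul, mul_one]
  rw [h, h', grigX_eq_pairAut, autC_conj_pairAut, pairAut_mul, ← grigX_eq_pairAut]
  congr 1
  · simp only [grigT, mul_assoc, autA_mul_autA_mul, autC_mul_autC_mul, autA_mul_self]
  · simp only [grigX, grigT_inv, mul_assoc, autC_mul_autD_mul, autC_mul_autD]

theorem grigX_commutator_grigT_inv :
    ⁅grigX, grigT⁻¹⁆ = pairAut (autC * grigX * autC) 1 := by
  have h : ⁅grigX, grigT⁻¹⁆ = grigX * (autA * (autC * grigX⁻¹ * autC) * autA) := by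
    rw [commutatorElement_def, inv_inv, grigT_inv, grigT]
    simp only [mul_assoc]
  rw [h, grigX_eq_pairAut, pairAut_inv, autC_conj_pairAut, autA_conj_pairAut, pairAut_mul,
    ← grigX_eq_pairAut]
  congr 1
  · simp only [grigX, grigT, inv_inv, mul_assoc, autD_mul_autC_mul, autB_mul_autC]
  · simp only [grigT_inv, mul_assoc, autA_mul_autA_mul, autC_mul_autC_mul, autA_mul_self]

-- The subgroup `K` and the copy of `K × K` inside it

/-- The subgroup `K`, the normal closure of `x` in the Grigorchuk group. -/
def branchK : Subgroup (TreeAut Bool) :=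
  Subgroup.closure {k | ∃ g ∈ Grigorchuk, k = g * grigX * g⁻¹}

theorem grigX_mem_branchK : grigX ∈ branchK :=
  Subgroup.subset_closure ⟨1, one_mem _, by group⟩

theorem branchK_le_Grigorchuk : branchK ≤ Grigorchuk := by
  rw [branchK, Subgroup.closure_le]
  rintro _ ⟨g, hg, rfl⟩
  exact mul_mem (mul_mem hg grigX_mem_Grigorchuk) (inv_mem hg)

theorem branchK_le {H : Subgroup (TreeAut Bool)} (hx : grigX ∈ H)
    (ha : ∀ h ∈ H, autA * h * autA ∈ H) (hb : ∀ h ∈ H, autB * h * autB ∈ H)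
    (hd : ∀ h ∈ H, autD * h * autD ∈ H) : branchK ≤ H := by
  rw [branchK, Subgroup.closure_le]
  rintro _ ⟨g, hg, rfl⟩
  exact Grigorchuk_le_normalizer ha hb hd hg hx

theorem conj_mem_branchK : ∀ g ∈ Grigorchuk, ∀ k ∈ branchK, g * k * g⁻¹ ∈ branchK := by
  intro g hg k hk
  unfold branchK at hk
  induction hk using Subgroup.closure_induction with
  | mem k hk =>
    obtain ⟨h, hh, rfl⟩ := hk
    exact Subgroup.subset_closure ⟨g * h, mul_mem hg hh, by group⟩
  | one => simp
  | mul k l _ _ hk hl =>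
    have e : g * (k * l) * g⁻¹ = (g * k * g⁻¹) * (g * l * g⁻¹) := by group
    rw [e]
    exact mul_mem hk hl
  | inv k _ hk =>
    have e : g * k⁻¹ * g⁻¹ = (g * k * g⁻¹)⁻¹ := by group
    rw [e]
    exact inv_mem hk

theorem autA_conj_mem_branchK {k : TreeAut Bool} (hk : k ∈ branchK) :
    autA * k * autA ∈ branchK := autA_inv ▸ conj_mem_branchK _ autA_mem_Grigorchuk k hk

theorem autB_conj_mem_branchK {k : TreeAut Bool} (hk : k ∈ branchK) :
    autB * k * autB ∈ branchK := autB_inv ▸ conj_mem_branchK _ autB_mem_Grigorchuk k hk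

theorem autC_conj_mem_branchK {k : TreeAut Bool} (hk : k ∈ branchK) :
    autC * k * autC ∈ branchK := autC_inv ▸ conj_mem_branchK _ autC_mem_Grigorchuk k hk

theorem autD_conj_mem_branchK {k : TreeAut Bool} (hk : k ∈ branchK) :
    autD * k * autD ∈ branchK := autD_inv ▸ conj_mem_branchK _ autD_mem_Grigorchuk k hk

/-- The admissible second entries include `x` and are stable under conjugation by `a`, `b`, `d`,
because `aba = (c, a)`, `d = (1, b)` and `c = (a, d)` realise these conjugations on the second
coordinate. -/
theorem pairAut_one_left_mem_branchK {k : TreeAut Bool} (hk : k ∈ branchK) :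
    pairAut 1 k ∈ branchK := by
  let H : Subgroup (TreeAut Bool) :=
    { carrier := {k : TreeAut Bool | pairAut 1 k ∈ branchK}
      one_mem' := by
        change pairAut 1 1 ∈ branchK
        rw [pairAut_one]
        exact one_mem _
      mul_mem' := fun {u v} hu hv => by
        change pairAut 1 (u * v) ∈ branchK
        have := branchK.mul_mem hu hv
        rwa [pairAut_mul, one_mul] at this
      inv_mem' := fun {u} hu => by
        change pairAut 1 u⁻¹ ∈ branchK
        have := branchK.inv_mem hu
        rwa [pairAut_inv, inv_one] at this }
  have key : branchK ≤ H := by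
    refine branchK_le ?_ ?_ ?_ ?_
    · change pairAut 1 grigX ∈ branchK
      rw [← grigX_commutator_grigT, commutatorElement_def, mul_assoc, mul_assoc,
        ← mul_assoc grigT]
      exact mul_mem grigX_mem_branchK
        (conj_mem_branchK _ grigT_mem_Grigorchuk _ (inv_mem grigX_mem_branchK))
    · intro k hk
      have h := autA_conj_mem_branchK (autB_conj_mem_branchK (autA_conj_mem_branchK hk))
      rwa [autA_conj_pairAut, autB_conj_pairAut, autA_conj_pairAut, mul_one, autC_mul_self] at h
    · intro k hk
      have h := autD_conj_mem_branchK hk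
      rwa [autD_conj_pairAut] at h
    · intro k hk
      have h := autC_conj_mem_branchK hk
      rwa [autC_conj_pairAut, mul_one, autA_mul_self] at h
  exact key hk

theorem pairSubgroup_branchK_le : pairSubgroup branchK ≤ branchK := by
  rintro _ ⟨u, hu, v, hv, rfl⟩
  have h := mul_mem (autA_conj_mem_branchK (pairAut_one_left_mem_branchK hu))
    (pairAut_one_left_mem_branchK hv)
  rwa [autA_conj_pairAut, pairAut_mul, mul_one, one_mul] at h

/-! ### Degrees of elements of the branching subgroup -/

/-- The geometric copy `K₁` of `K × K` in `K`. -/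
def branchK₁ : Subgroup (TreeAut Bool) := pairSubgroup branchK

/-- The geometric copy `K₂` of `K₁ × K₁` in `K₁`. -/
def branchK₂ : Subgroup (TreeAut Bool) := pairSubgroup branchK₁

theorem branchK₁_le_branchK : branchK₁ ≤ branchK := pairSubgroup_branchK_le

theorem branchK₂_le_branchK₁ : branchK₂ ≤ branchK₁ := pairSubgroup_mono branchK₁_le_branchK

theorem conj_mem_branchK₁ : ∀ g ∈ Grigorchuk, ∀ k ∈ branchK₁, g * k * g⁻¹ ∈ branchK₁ :=
  conj_mem_pairSubgroup conj_mem_branchK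

theorem conj_mem_branchK₂ : ∀ g ∈ Grigorchuk, ∀ k ∈ branchK₂, g * k * g⁻¹ ∈ branchK₂ :=
  conj_mem_pairSubgroup conj_mem_branchK₁

/-- `k` has degree `i` if `k` is congruent to `x ^ i` modulo `K₁`. The degree is determined only
modulo `4`. -/
def HasDegree (k : TreeAut Bool) (i : ℤ) : Prop := grigX ^ (-i) * k ∈ branchK₁

theorem hasDegree_zero {k : TreeAut Bool} : HasDegree k 0 ↔ k ∈ branchK₁ := by
  simp [HasDegree]

theorem hasDegree_grigX : HasDegree grigX 1 := by
  simp [HasDegree, one_mem]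

theorem hasDegree_grigX_zpow (i : ℤ) : HasDegree (grigX ^ i) i := by
  simp [HasDegree, one_mem]

theorem HasDegree.mem {k : TreeAut Bool} {i : ℤ} (h : HasDegree k i) : k ∈ branchK := by
  have := mul_mem (zpow_mem grigX_mem_branchK i) (branchK₁_le_branchK h)
  simpa using this

theorem HasDegree.mul {k l : TreeAut Bool} {i j : ℤ} (hk : HasDegree k i) (hl : HasDegree l j) :
    HasDegree (k * l) (i + j) := by
  have h := mul_mem (conj_mem_branchK₁ _ (zpow_mem grigX_mem_Grigorchuk (-j)) _ hk) hl
  unfold HasDegree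
  convert h using 1
  group

theorem HasDegree.inv {k : TreeAut Bool} {i : ℤ} (hk : HasDegree k i) : HasDegree k⁻¹ (-i) := by
  have h := inv_mem (conj_mem_branchK₁ _ (zpow_mem grigX_mem_Grigorchuk i) _ hk)
  unfold HasDegree
  convert h using 1
  group

theorem HasDegree.zpow {k : TreeAut Bool} {i : ℤ} (hk : HasDegree k i) (n : ℤ) :
    HasDegree (k ^ n) (n * i) := by
  induction n with
  | zero => simpa using hasDegree_zero.2 (one_mem _)
  | succ n ih =>
    rw [zpow_add_one, add_mul, one_mul]
    exact ih.mul hk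
  | pred n ih =>
    rw [zpow_sub_one, sub_mul, one_mul, sub_eq_add_neg]
    exact ih.mul hk.inv

theorem HasDegree.commutator {k l : TreeAut Bool} {i j : ℤ} (hk : HasDegree k i)
    (hl : HasDegree l j) : ⁅k, l⁆ ∈ branchK₁ := by
  have h := ((hk.mul hl).mul hk.inv).mul hl.inv
  rw [show i + j + -i + -j = 0 by ring] at h
  exact hasDegree_zero.1 h

/-- If conjugation by `s` multiplies the degree of `x` by `ε`, it does so for every degree. -/
theorem HasDegree.conj {s : TreeAut Bool} (hs : s ∈ Grigorchuk) {ε : ℤ}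
    (hx : HasDegree (s * grigX * s⁻¹) ε) {k : TreeAut Bool} {i : ℤ} (hk : HasDegree k i) :
    HasDegree (s * k * s⁻¹) (i * ε) := by
  have h := (hx.zpow i).mul (hasDegree_zero.2 (conj_mem_branchK₁ s hs _ hk))
  rw [conj_zpow, add_zero] at h
  convert h using 1
  group

theorem HasDegree.autA_conj {k : TreeAut Bool} {i : ℤ} (hk : HasDegree k i) :
    HasDegree (autA * k * autA) (-i) := by
  have h := HasDegree.conj (ε := -1) autA_mem_Grigorchuk
    (by rw [autA_inv, autA_conj_grigX]; exact hasDegree_grigX.inv) hk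
  rwa [autA_inv, mul_neg_one] at h

theorem HasDegree.autB_conj {k : TreeAut Bool} {i : ℤ} (hk : HasDegree k i) :
    HasDegree (autB * k * autB) (-i) := by
  have h := HasDegree.conj (ε := -1) autB_mem_Grigorchuk
    (by rw [autB_inv, autB_conj_grigX]; exact hasDegree_grigX.inv) hk
  rwa [autB_inv, mul_neg_one] at h

theorem HasDegree.autD_conj {k : TreeAut Bool} {i : ℤ} (hk : HasDegree k i) :
    HasDegree (autD * k * autD) i := by
  have h := HasDegree.conj (ε := 1) autD_mem_Grigorchuk (by
    rw [autD_inv, autD_conj_grigX, ← add_zero (1 : ℤ)]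
    exact hasDegree_grigX.mul (hasDegree_zero.2 (pairAut_mem_pairSubgroup (one_mem _)
      (autC_conj_mem_branchK grigX_mem_branchK)))) hk
  rwa [autD_inv, mul_one] at h

theorem HasDegree.autC_conj {k : TreeAut Bool} {i : ℤ} (hk : HasDegree k i) :
    HasDegree (autC * k * autC) (-i) := by
  have h := hk.autD_conj.autB_conj
  rw [← autB_mul_autD]
  nth_rw 2 [autB_mul_autD]
  rw [← autD_mul_autB]
  simpa only [mul_assoc] using h

/-- Conjugation by each generator sends `x` to `x` or `x⁻¹` modulo `K₁`, so the powers of `x`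
already exhaust `K/K₁`. -/
theorem exists_hasDegree {k : TreeAut Bool} (hk : k ∈ branchK) : ∃ i, HasDegree k i := by
  let H : Subgroup (TreeAut Bool) :=
    { carrier := {k : TreeAut Bool | ∃ i, HasDegree k i}
      one_mem' := ⟨0, hasDegree_zero.2 (one_mem _)⟩
      mul_mem' := fun ⟨_, hu⟩ ⟨_, hv⟩ => ⟨_, hu.mul hv⟩
      inv_mem' := fun ⟨_, hu⟩ => ⟨_, hu.inv⟩ }
  have key : branchK ≤ H := branchK_le ⟨1, hasDegree_grigX⟩
    (fun _ ⟨_, h⟩ => ⟨_, h.autA_conj⟩) (fun _ ⟨_, h⟩ => ⟨_, h.autB_conj⟩)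
    (fun _ ⟨_, h⟩ => ⟨_, h.autD_conj⟩)
  exact key hk

theorem autD_mul_autA_pow_four : (autD * autA) ^ 4 = 1 := by
  have h2 : (autD * autA) ^ 2 = pairAut autB autB := by
    rw [pow_two, mul_assoc, ← mul_assoc autA, autD_eq_pairAut, autA_conj_pairAut, pairAut_mul,
      one_mul, mul_one]
  rw [show 4 = 2 * 2 from rfl, pow_mul, h2, pow_two, pairAut_mul, autB_mul_self, pairAut_one]

/-- Modulo `K`, `t²` equals `(da)²`, whose square is trivial. As `x⁴ = (t⁴, t⁻⁴)`, this is why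
degrees only matter modulo `4`. -/
theorem grigT_pow_four_mem_branchK : grigT ^ 4 ∈ branchK := by
  have hk : autC * grigX * autC ∈ branchK := autC_conj_mem_branchK grigX_mem_branchK
  have ht : grigT ^ 2 = (autC * grigX * autC) * (autD * autA) ^ 2 := by
    simp only [grigT, grigX, pow_two, mul_assoc, autC_mul_autD_mul, autB_mul_autB_mul,
      autA_mul_autA_mul, autB_mul_autD_mul]
  have hg : (autD * autA) ^ 2 ∈ Grigorchuk :=
    pow_mem (mul_mem autD_mem_Grigorchuk autA_mem_Grigorchuk) 2
  have h := mul_mem hk (conj_mem_branchK _ hg _ hk)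
  have e : grigT ^ 4 = (autC * grigX * autC) *
      ((autD * autA) ^ 2 * (autC * grigX * autC) * ((autD * autA) ^ 2)⁻¹) * (autD * autA) ^ 4 := by
    rw [show 4 = 2 * 2 from rfl, pow_mul, pow_mul, ht, pow_two, pow_two (_ ^ 2)]
    group
  rwa [e, autD_mul_autA_pow_four, mul_one]

theorem grigX_pow_four_mem_branchK₁ : grigX ^ (4 : ℤ) ∈ branchK₁ := by
  have e : grigX ^ (4 : ℤ) = pairAut (grigT ^ 4) (grigT ^ 4)⁻¹ := by
    rw [show (4 : ℤ) = ((4 : ℕ) : ℤ) from rfl, zpow_natCast, grigX_eq_pairAut]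
    simp only [pow_succ, pow_zero, one_mul, pairAut_mul, mul_inv_rev, mul_assoc]
  rw [e]
  exact pairAut_mem_pairSubgroup grigT_pow_four_mem_branchK (inv_mem grigT_pow_four_mem_branchK)

theorem HasDegree.mem_branchK₁ {k : TreeAut Bool} {i : ℤ} (hk : HasDegree k i) (hi : 4 ∣ i) :
    k ∈ branchK₁ := by
  obtain ⟨j, rfl⟩ := hi
  have h := mul_mem (zpow_mem grigX_pow_four_mem_branchK₁ j) hk
  rwa [← zpow_mul, ← mul_assoc, ← zpow_add, add_neg_cancel, zpow_zero, one_mul] at h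

/-! ### Classes of pairs -/

/-- `p` has class `(i, j)` if it is a pair of elements of `K` of degrees `i` and `j`. -/
def HasClass (p : TreeAut Bool) (i j : ℤ) : Prop :=
  ∃ u v, HasDegree u i ∧ HasDegree v j ∧ p = pairAut u v

theorem HasClass.mul {p q : TreeAut Bool} {i j k l : ℤ} (hp : HasClass p i j)
    (hq : HasClass q k l) : HasClass (p * q) (i + k) (j + l) := by
  obtain ⟨u, v, hu, hv, rfl⟩ := hp
  obtain ⟨u', v', hu', hv', rfl⟩ := hq
  exact ⟨_, _, hu.mul hu', hv.mul hv', pairAut_mul ..⟩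

theorem HasClass.inv {p : TreeAut Bool} {i j : ℤ} (hp : HasClass p i j) :
    HasClass p⁻¹ (-i) (-j) := by
  obtain ⟨u, v, hu, hv, rfl⟩ := hp
  exact ⟨_, _, hu.inv, hv.inv, pairAut_inv ..⟩

theorem HasClass.mem {p : TreeAut Bool} {i j : ℤ} (hp : HasClass p i j) : p ∈ branchK₁ := by
  obtain ⟨u, v, hu, hv, rfl⟩ := hp
  exact pairAut_mem_pairSubgroup hu.mem hv.mem

theorem exists_hasClass {p : TreeAut Bool} (hp : p ∈ branchK₁) : ∃ i j, HasClass p i j := by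
  obtain ⟨u, hu, v, hv, rfl⟩ := hp
  obtain ⟨i, hi⟩ := exists_hasDegree hu
  obtain ⟨j, hj⟩ := exists_hasDegree hv
  exact ⟨i, j, u, v, hi, hj, rfl⟩

theorem exists_of_class (i j : ℤ) : ∃ p, HasClass p i j :=
  ⟨_, _, _, hasDegree_grigX_zpow i, hasDegree_grigX_zpow j, rfl⟩

theorem hasClass_zero {p : TreeAut Bool} (hp : p ∈ branchK₂) : HasClass p 0 0 := by
  obtain ⟨u, hu, v, hv, rfl⟩ := hp
  exact ⟨u, v, hasDegree_zero.2 hu, hasDegree_zero.2 hv, rfl⟩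

theorem HasClass.mem_branchK₂ {p : TreeAut Bool} {i j : ℤ} (hp : HasClass p i j) (hi : 4 ∣ i)
    (hj : 4 ∣ j) : p ∈ branchK₂ := by
  obtain ⟨u, v, hu, hv, rfl⟩ := hp
  exact pairAut_mem_pairSubgroup (hu.mem_branchK₁ hi) (hv.mem_branchK₁ hj)

/-- The elements of the Grigorchuk group that commute with `X` modulo a subgroup `N` that is
normalised by the Grigorchuk group. -/
def centralizerMod (N : Subgroup (TreeAut Bool))
    (hN : ∀ g ∈ Grigorchuk, ∀ k ∈ N, g * k * g⁻¹ ∈ N) (X : Set (TreeAut Bool)) :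
    Subgroup (TreeAut Bool) where
  carrier := {l | l ∈ Grigorchuk ∧ ∀ p ∈ X, ⁅l, p⁆ ∈ N}
  one_mem' := ⟨one_mem _, fun p _ => by simp [one_mem]⟩
  mul_mem' := by
    rintro l m ⟨hl, hl'⟩ ⟨hm, hm'⟩
    refine ⟨mul_mem hl hm, fun p hp => ?_⟩
    have e : ⁅l * m, p⁆ = l * ⁅m, p⁆ * l⁻¹ * ⁅l, p⁆ := by
      simp only [commutatorElement_def]; group
    rw [e]
    exact mul_mem (hN l hl _ (hm' p hp)) (hl' p hp)
  inv_mem' := by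
    rintro l ⟨hl, hl'⟩
    refine ⟨inv_mem hl, fun p hp => ?_⟩
    have e : ⁅l⁻¹, p⁆ = l⁻¹ * ⁅l, p⁆⁻¹ * l⁻¹⁻¹ := by
      simp only [commutatorElement_def]; group
    rw [e]
    exact hN _ (inv_mem hl) _ (inv_mem (hl' p hp))

theorem HasDegree.grigT_conj {k : TreeAut Bool} {i : ℤ} (hk : HasDegree k i) :
    HasDegree (grigT * k * grigT⁻¹) i := by
  have h := hk.autA_conj.autC_conj
  rw [neg_neg] at h
  rw [grigT_inv, grigT]
  simpa only [mul_assoc] using h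

theorem HasDegree.commutator_grigT {k : TreeAut Bool} {i : ℤ} (hk : HasDegree k i) :
    ⁅grigT, k⁆ ∈ branchK₁ := by
  rw [commutatorElement_def, ← hasDegree_zero, ← add_neg_cancel i]
  exact hk.grigT_conj.mul hk.inv

theorem HasDegree.commutator_grigT_inv {k : TreeAut Bool} {i : ℤ} (hk : HasDegree k i) :
    ⁅grigT⁻¹, k⁆ ∈ branchK₁ := by
  have e : ⁅grigT⁻¹, k⁆ = grigT⁻¹ * ⁅grigT, k⁆⁻¹ * grigT⁻¹⁻¹ := by
    simp only [commutatorElement_def]; group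
  rw [e]
  exact conj_mem_branchK₁ _ (inv_mem grigT_mem_Grigorchuk) _ (inv_mem hk.commutator_grigT)

/-- The derived subgroup of `K` is contained in `K₂`. -/
theorem commutator_mem_branchK₂ {k l : TreeAut Bool} (hk : k ∈ branchK) (hl : l ∈ branchK) :
    ⁅k, l⁆ ∈ branchK₂ := by
  let Z := centralizerMod branchK₂ conj_mem_branchK₂
  have hle : ∀ X, grigX ∈ Z X → branchK₁ ≤ Z X → branchK ≤ Z X := by
    intro X hx h1 k hk
    obtain ⟨i, hi⟩ := exists_hasDegree hk
    have := mul_mem (zpow_mem hx i) (h1 hi)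
    simpa using this
  have hG : branchK₁ ≤ Grigorchuk := branchK₁_le_branchK.trans branchK_le_Grigorchuk
  -- `K` centralises `K₁` modulo `K₂`: both entries of `x = (t, t⁻¹)` preserve degrees, and `K₁` is
  -- abelian modulo `K₂` because `K` is cyclic modulo `K₁`.
  have h1 : branchK ≤ Z branchK₁ := by
    refine hle _ ⟨grigX_mem_Grigorchuk, ?_⟩ fun p hp => ⟨hG hp, ?_⟩
    · rintro _ ⟨u, hu, v, hv, rfl⟩
      obtain ⟨i, hi⟩ := exists_hasDegree hu
      obtain ⟨j, hj⟩ := exists_hasDegree hv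
      rw [grigX_eq_pairAut, pairAut_commutator]
      exact pairAut_mem_pairSubgroup hi.commutator_grigT hj.commutator_grigT_inv
    · rintro _ ⟨u, hu, v, hv, rfl⟩
      obtain ⟨u', hu', v', hv', rfl⟩ := hp
      obtain ⟨i, hi⟩ := exists_hasDegree hu
      obtain ⟨j, hj⟩ := exists_hasDegree hv
      obtain ⟨i', hi'⟩ := exists_hasDegree hu'
      obtain ⟨j', hj'⟩ := exists_hasDegree hv'
      rw [pairAut_commutator]
      exact pairAut_mem_pairSubgroup (hi'.commutator hi) (hj'.commutator hj)
  have symm : ∀ {k l : TreeAut Bool}, ⁅k, l⁆ ∈ branchK₂ → ⁅l, k⁆ ∈ branchK₂ := fun h => by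
    rw [← commutatorElement_inv]
    exact inv_mem h
  -- As `K` is generated by `x` and `K₁`, it remains only to commute with `x`.
  have h2 : branchK ≤ Z {grigX} := by
    refine hle _ ⟨grigX_mem_Grigorchuk, ?_⟩ fun p hp => ⟨hG hp, ?_⟩
    · rintro _ rfl
      rw [commutatorElement_self]
      exact one_mem _
    · rintro _ rfl
      exact symm ((h1 grigX_mem_branchK).2 p hp)
  have h3 : branchK ≤ Z branchK :=
    hle _ ⟨grigX_mem_Grigorchuk, fun p hp => symm ((h2 hp).2 _ rfl)⟩
      fun p hp => ⟨hG hp, fun q hq => symm ((h1 hq).2 p hp)⟩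
  exact (h3 hk).2 l hl

/-! ### Approximate commutators -/

/-- Every `c ∈ C` is a commutator modulo `D`, of an element of `X` known up to `Y` and an element
of `X'` known up to `Y'`. -/
def CommutatorApprox (X Y X' Y' C D : Set (TreeAut Bool)) : Prop :=
  ∀ c ∈ C, ∃ g ∈ X, ∃ h ∈ X', ∀ e ∈ Y, ∀ f ∈ Y', ∃ d ∈ D, c = ⁅g * e⁻¹, h * f⁻¹⁆ * d

/-- The set of pairs of elements of `X`. -/
def pairSet (X : Set (TreeAut Bool)) : Set (TreeAut Bool) :=
  {p | ∃ u ∈ X, ∃ v ∈ X, p = pairAut u v}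

theorem pairSet_mono {X Y : Set (TreeAut Bool)} (h : X ⊆ Y) : pairSet X ⊆ pairSet Y := by
  rintro _ ⟨u, hu, v, hv, rfl⟩
  exact ⟨u, h hu, v, h hv, rfl⟩

theorem pairSet_iterate_mono {X Y : Set (TreeAut Bool)} (h : X ⊆ Y) (m : ℕ) :
    pairSet^[m] X ⊆ pairSet^[m] Y := by
  induction m with
  | zero => exact h
  | succ m ih =>
    rw [Function.iterate_succ_apply', Function.iterate_succ_apply']
    exact pairSet_mono ih

/-- The two coordinates may use different right-hand sets `X₀` and `X₁`, as the pair `x = (t, t⁻¹)`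
requires. -/
theorem CommutatorApprox.pair {X Y X₀ X₁ Y' C D : Set (TreeAut Bool)}
    (h₀ : CommutatorApprox X Y X₀ Y' C D) (h₁ : CommutatorApprox X Y X₁ Y' C D)
    {Z : Set (TreeAut Bool)} (hZ : ∀ u ∈ X₀, ∀ v ∈ X₁, pairAut u v ∈ Z) :
    CommutatorApprox (pairSet X) (pairSet Y) Z (pairSet Y') (pairSet C) (pairSet D) := by
  rintro _ ⟨c₀, hc₀, c₁, hc₁, rfl⟩
  obtain ⟨g₀, hg₀, k₀, hk₀, H₀⟩ := h₀ c₀ hc₀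
  obtain ⟨g₁, hg₁, k₁, hk₁, H₁⟩ := h₁ c₁ hc₁
  refine ⟨_, ⟨g₀, hg₀, g₁, hg₁, rfl⟩, _, hZ _ hk₀ _ hk₁, ?_⟩
  rintro _ ⟨e₀, he₀, e₁, he₁, rfl⟩ _ ⟨f₀, hf₀, f₁, hf₁, rfl⟩
  obtain ⟨d₀, hd₀, H₀⟩ := H₀ e₀ he₀ f₀ hf₀
  obtain ⟨d₁, hd₁, H₁⟩ := H₁ e₁ he₁ f₁ hf₁
  refine ⟨_, ⟨d₀, hd₀, d₁, hd₁, rfl⟩, ?_⟩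
  rw [pairAut_inv, pairAut_inv, pairAut_mul, pairAut_mul, pairAut_commutator, pairAut_mul, ← H₀,
    ← H₁]

theorem CommutatorApprox.iterate {X Y X' Y' C D : Set (TreeAut Bool)}
    (h : CommutatorApprox X Y X' Y' C D) (m : ℕ) :
    CommutatorApprox (pairSet^[m] X) (pairSet^[m] Y) (pairSet^[m] X') (pairSet^[m] Y')
      (pairSet^[m] C) (pairSet^[m] D) := by
  induction m with
  | zero => exact h
  | succ m ih =>
    simp only [Function.iterate_succ_apply']
    exact ih.pair ih fun u hu v hv => ⟨u, hu, v, hv, rfl⟩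

-- Commutators with an element that rotates classes

/-- The elements of `K₁` some class of which satisfies `P`. -/
def classSet (P : ℤ → ℤ → Prop) : Set (TreeAut Bool) :=
  {p | ∃ i j, P i j ∧ HasClass p i j}

/-- Conjugation by `τ` acts on classes by the rotation `(i, j) ↦ (-εj, εi)`, where `ε = ±1`, and
the commutator of `x` and `τ` has odd class. -/
structure IsRotation (τ : TreeAut Bool) (ε : ℤ) : Prop where
  sign : ε = 1 ∨ ε = -1
  mem : τ ∈ Grigorchuk
  conj : ∀ p i j, HasClass p i j → HasClass (τ * p * τ⁻¹) (-(ε * j)) (ε * i)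
  odd : ∃ r s, HasClass ⁅grigX, τ⁆ r s ∧ (r + s) % 2 = 1

/-- Conjugation by `t` swaps the entries and then conjugates them by `a` and `d`; the first negates
the degree and the second keeps it. -/
theorem isRotation_grigT : IsRotation grigT 1 where
  sign := Or.inl rfl
  mem := grigT_mem_Grigorchuk
  conj := by
    rintro _ i j ⟨u, v, hu, hv, rfl⟩
    have e : grigT * pairAut u v * grigT⁻¹ = pairAut (autA * v * autA) (autD * u * autD) := by
      rw [← autC_conj_pairAut, ← autA_conj_pairAut u v, grigT_inv, grigT]
      simp only [mul_assoc]
    rw [e, one_mul, one_mul]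
    exact ⟨_, _, hv.autA_conj, hu.autD_conj, rfl⟩
  odd := by
    rw [grigX_commutator_grigT]
    exact ⟨0, 1, ⟨_, _, hasDegree_zero.2 (one_mem _), hasDegree_grigX, rfl⟩, rfl⟩

theorem isRotation_grigT_inv : IsRotation grigT⁻¹ (-1) where
  sign := Or.inr rfl
  mem := inv_mem grigT_mem_Grigorchuk
  conj := by
    rintro _ i j ⟨u, v, hu, hv, rfl⟩
    have e : grigT⁻¹ * pairAut u v * grigT⁻¹⁻¹ = pairAut (autD * v * autD) (autA * u * autA) := by
      rw [← autA_conj_pairAut (autA * u * autA), ← autC_conj_pairAut, inv_inv, grigT_inv, grigT]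
      simp only [mul_assoc]
    rw [e, neg_one_mul, neg_one_mul, neg_neg]
    exact ⟨_, _, hv.autD_conj, hu.autA_conj, rfl⟩
  odd := by
    rw [grigX_commutator_grigT_inv]
    exact ⟨-1, 0, ⟨_, _, hasDegree_grigX.autC_conj, hasDegree_zero.2 (one_mem _), rfl⟩, rfl⟩

theorem HasClass.conj_branchK {p k : TreeAut Bool} {i j : ℤ} (hp : HasClass p i j)
    (hk : k ∈ branchK) : HasClass (k * p * k⁻¹) i j := by
  have h := (hasClass_zero (commutator_mem_branchK₂ hk (branchK₁_le_branchK hp.mem))).mul hp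
  rw [zero_add, zero_add] at h
  convert h using 1
  rw [commutatorElement_def]
  group

theorem commutator_mul_right' {G : Type*} [Group G] (p τ f : G) :
    ⁅p, τ * f⁆ = ⁅p, τ⁆ * (τ * ⁅p, f⁆ * τ⁻¹) := by
  simp only [commutatorElement_def]
  group

theorem commutator_mul_left' {G : Type*} [Group G] (x p h : G) :
    ⁅x * p, h⁆ = x * ⁅p, h⁆ * x⁻¹ * ⁅x, h⁆ := by
  simp only [commutatorElement_def]
  group

namespace IsRotation

variable {τ : TreeAut Bool} {ε : ℤ}

theorem conj_commutator_mem (h : IsRotation τ ε) {k f : TreeAut Bool} (hk : k ∈ branchK)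
    (hf : f ∈ branchK) : HasClass (τ * ⁅k, f⁆ * τ⁻¹) 0 0 :=
  hasClass_zero (conj_mem_branchK₂ _ h.mem _ (commutator_mem_branchK₂ hk hf))

/-- On Gaussian integers this is multiplication by `1 - ε√-1`. The error `f` contributes only a
conjugate of `⁅p, f⁆`, which lies in `K₂`. -/
theorem hasClass_commutator (h : IsRotation τ ε) {p f : TreeAut Bool} {i j : ℤ}
    (hp : HasClass p i j) (hf : f ∈ branchK) :
    HasClass ⁅p, τ * f⁆ (i + ε * j) (j - ε * i) := by
  have h1 := hp.mul (h.conj _ _ _ hp.inv)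
  have h2 := h1.mul (h.conj_commutator_mem (branchK₁_le_branchK hp.mem) hf)
  rw [commutator_mul_right', commutatorElement_def p τ]
  convert h2 using 1
  · simp only [mul_assoc]
  · ring
  · ring

theorem odd_commutator (h : IsRotation τ ε) {f : TreeAut Bool} (hf : f ∈ branchK) :
    ∃ r s, HasClass ⁅grigX, τ * f⁆ r s ∧ (r + s) % 2 = 1 := by
  obtain ⟨r, s, hrs, ho⟩ := h.odd
  refine ⟨r, s, ?_, ho⟩
  have := hrs.mul (h.conj_commutator_mem grigX_mem_branchK hf)
  rwa [add_zero, add_zero, ← commutator_mul_right'] at this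

/-- Approximating by commutators inside `K₁` becomes pure arithmetic of classes: `(i', j')` is the
class of the left entry, `(k, l)` that of its error, and `R` is asked of the class of the remainder.
-/
theorem commutatorApprox_classSet (h : IsRotation τ ε) {P Q R : ℤ → ℤ → Prop}
    (hP : ∀ i j, Q i j → ∃ i' j', P i' j' ∧ ∀ k l, Q k l →
      R (-((i' - k) + ε * (j' - l)) + i) (-((j' - l) - ε * (i' - k)) + j)) :
    CommutatorApprox (classSet P) (classSet Q) {τ} branchK (classSet Q) (classSet R) := by
  rintro c ⟨i, j, hij, hc⟩
  obtain ⟨i', j', hij', H⟩ := hP i j hij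
  obtain ⟨g, hg⟩ := exists_of_class i' j'
  refine ⟨g, ⟨i', j', hij', hg⟩, τ, rfl, ?_⟩
  rintro e ⟨k, l, hkl, he⟩ f hf
  refine ⟨⁅g * e⁻¹, τ * f⁻¹⁆⁻¹ * c, ⟨_, _, H k l hkl, ?_⟩, (mul_inv_cancel_left _ _).symm⟩
  have hge := hg.mul he.inv
  rw [← sub_eq_add_neg, ← sub_eq_add_neg] at hge
  exact (h.hasClass_commutator hge (inv_mem hf)).inv.mul hc

theorem commutatorApprox_branchK (h : IsRotation τ ε) :
    CommutatorApprox branchK (classSet fun _ _ => True) {τ} branchK (classSet fun _ _ => True)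
      (classSet fun i j => 2 ∣ i + j) := by
  rintro c ⟨i, j, -, hc⟩
  have key : ∃ g ∈ branchK, ∀ e, (∃ k l, True ∧ HasClass e k l) → ∀ f ∈ branchK,
      ∃ r s, HasClass ⁅g * e⁻¹, τ * f⁻¹⁆ r s ∧ 2 ∣ i + j - (r + s) := by
    -- Multiples of `1 - ε√-1` have even coordinate sum, so an error `e` in `K₁` does not affect the
    -- parity. Hence `1` serves the even classes and `x` the odd ones.
    have hsum : ∀ k l : ℤ, ∃ m, (-k + ε * -l) + (-l - ε * -k) = 2 * m := by
      intro k l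
      rcases h.sign with rfl | rfl
      · exact ⟨-l, by ring⟩
      · exact ⟨-k, by ring⟩
    rcases Int.emod_two_eq_zero_or_one (i + j) with h0 | h1
    · refine ⟨1, one_mem _, ?_⟩
      rintro e ⟨k, l, -, he⟩ f hf
      rw [one_mul]
      refine ⟨_, _, h.hasClass_commutator he.inv (inv_mem hf), ?_⟩
      obtain ⟨m, hm⟩ := hsum k l
      omega
    · refine ⟨grigX, grigX_mem_branchK, ?_⟩
      rintro e ⟨k, l, -, he⟩ f hf
      obtain ⟨r, s, hrs, ho⟩ := h.odd_commutator (inv_mem hf)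
      rw [commutator_mul_left']
      refine ⟨_, _, ((h.hasClass_commutator he.inv (inv_mem hf)).conj_branchK
        grigX_mem_branchK).mul hrs, ?_⟩
      obtain ⟨m, hm⟩ := hsum k l
      omega
  obtain ⟨g, hg, H⟩ := key
  refine ⟨g, hg, τ, rfl, fun e he f hf => ?_⟩
  obtain ⟨r, s, hrs, hd⟩ := H e he f hf
  refine ⟨⁅g * e⁻¹, τ * f⁻¹⁆⁻¹ * c, ⟨_, _, ?_, hrs.inv.mul hc⟩, (mul_inv_cancel_left _ _).symm⟩
  change 2 ∣ -r + i + (-s + j)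
  omega

end IsRotation

/-- The chain of subsets from `K` down to a subset of `K₂`. -/
def branchChain : ℕ → Set (TreeAut Bool)
  | 0 => branchK
  | 1 => classSet fun _ _ => True
  | 2 => classSet fun i j => 2 ∣ i + j
  | 3 => classSet fun i j => 2 ∣ i ∧ 2 ∣ j
  | 4 => classSet fun i j => 2 ∣ i ∧ 2 ∣ j ∧ 4 ∣ i + j
  | _ => classSet fun i j => 4 ∣ i ∧ 4 ∣ j

theorem branchChain_one : branchChain 1 = pairSet branchK := by
  ext p
  constructor
  · rintro ⟨i, j, -, hp⟩
    exact hp.mem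
  · intro hp
    obtain ⟨i, j, h⟩ := exists_hasClass hp
    exact ⟨i, j, trivial, h⟩

theorem branchChain_five_subset : branchChain 5 ⊆ branchK₂ := by
  rintro p ⟨i, j, ⟨hi, hj⟩, hp⟩
  exact hp.mem_branchK₂ hi hj

theorem IsRotation.commutatorApprox_branchChain {τ : TreeAut Bool} {ε : ℤ} (h : IsRotation τ ε)
    {k : ℕ} (hk : k < 4) :
    CommutatorApprox (branchChain k) (branchChain (k + 1)) {τ} branchK (branchChain (k + 1))
      (branchChain (k + 2)) := by
  have hs := h.sign
  interval_cases k
  · exact h.commutatorApprox_branchK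
  · refine h.commutatorApprox_classSet fun i j hij =>
      -- The witness is the quotient of `i + j√-1` by `1 - ε√-1`, that is, its product with `(1 +
      -- ε√-1)/2`; it is integral because `i + j` is even.
      ⟨(i - ε * j) / 2, (j + ε * i) / 2, trivial, fun k l hkl => ?_⟩
    rcases hs with rfl | rfl <;> omega
  · refine h.commutatorApprox_classSet fun i j hij =>
      ⟨(i - ε * j) / 2, (j + ε * i) / 2, ?_, fun k l hkl => ?_⟩ <;>
    rcases hs with rfl | rfl <;> omega
  · refine h.commutatorApprox_classSet fun i j hij =>
      ⟨(i - ε * j) / 2, (j + ε * i) / 2, ?_, fun k l hkl => ?_⟩ <;>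
    rcases hs with rfl | rfl <;> omega

/-- Passing to pairs replaces the conjugators `t` and `t⁻¹` by the single element `x = (t, t⁻¹)` of
`K`, for which approximating words are available. -/
theorem commutatorApprox_pairSet_branchChain {k : ℕ} (hk : k < 4) :
    CommutatorApprox (pairSet (branchChain k)) (pairSet (branchChain (k + 1))) branchK
      (pairSet branchK) (pairSet (branchChain (k + 1))) (pairSet (branchChain (k + 2))) :=
  (isRotation_grigT.commutatorApprox_branchChain hk).pair
    (isRotation_grigT_inv.commutatorApprox_branchChain hk) <| by
      rintro _ rfl _ rfl
      rw [← grigX_eq_pairAut]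
      exact grigX_mem_branchK

/-! ### Word balls -/

section WordBall

variable {G : Type*} [Group G] {S : Set G}

theorem one_mem_wordBall (n : ℕ) : (1 : G) ∈ wordBall S n := ⟨[], by simp⟩

theorem mul_mem_wordBall {m n : ℕ} {g h : G} (hg : g ∈ wordBall S m) (hh : h ∈ wordBall S n) :
    g * h ∈ wordBall S (m + n) := by
  obtain ⟨l, hl, hS, rfl⟩ := hg
  obtain ⟨l', hl', hS', rfl⟩ := hh
  refine ⟨l ++ l', by simp; omega, ?_, by simp⟩
  intro x hx
  rcases List.mem_append.1 hx with hx | hx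
  exacts [hS x hx, hS' x hx]

theorem inv_mem_wordBall {n : ℕ} {g : G} (hg : g ∈ wordBall S n) : g⁻¹ ∈ wordBall S n := by
  obtain ⟨l, hl, hS, rfl⟩ := hg
  refine ⟨(l.map (·⁻¹)).reverse, by simpa, ?_, (List.prod_inv_reverse l).symm⟩
  intro x hx
  simp only [List.mem_reverse, List.mem_map] at hx
  obtain ⟨y, hy, rfl⟩ := hx
  rw [inv_inv]
  exact (hS y hy).symm

theorem wordBall_mono {m n : ℕ} (h : m ≤ n) : wordBall S m ⊆ wordBall S n := by
  rintro _ ⟨l, hl, hS, rfl⟩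
  exact ⟨l, hl.trans h, hS, rfl⟩

theorem mem_wordBall_one {s : G} (hs : s ∈ S) : s ∈ wordBall S 1 :=
  ⟨[s], by simp, by simp [hs], by simp⟩

theorem diamWrt_le {n : ℕ} (h : wordBall S n = Set.univ) : diamWrt S ≤ n := Nat.sInf_le h

theorem groupDiam_le {n : ℕ}
    (h : ∀ S : Set G, Subgroup.closure S = ⊤ → wordBall S n = Set.univ) : groupDiam G ≤ n := by
  refine csSup_le' ?_
  rintro _ ⟨S, hS, rfl⟩
  exact diamWrt_le (h S hS)

/-- Words of length at most the index of a subgroup represent all its cosets. -/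
theorem exists_wordBall_mul_mem (hS : Subgroup.closure S = ⊤) (H : Subgroup G) [H.FiniteIndex]
    {n : ℕ} (hn : H.index ≤ n) (g : G) : ∃ w ∈ wordBall S n, ∃ h ∈ H, g = w * h := by
  let B : ℕ → Set (G ⧸ H) := fun n => (fun g : G => (g : G ⧸ H)) '' wordBall S n
  have hmono : ∀ n, B n ⊆ B (n + 1) := fun n => Set.image_mono (wordBall_mono n.le_succ)
  -- Once the image of the ball stops growing, it is invariant under the whole group.
  have hfull : ∀ n, B (n + 1) ⊆ B n → B n = Set.univ := by
    intro n h
    have key : ∀ g ∈ Subgroup.closure S, ∀ q ∈ B n, g • q ∈ B n := by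
      intro g hg
      induction hg using Subgroup.closure_induction_left with
      | one => simp
      | mul_left s hs g _ ih =>
        intro q hq
        obtain ⟨w, hw, hq'⟩ := ih q hq
        rw [mul_smul, ← hq']
        refine h ⟨s * w, ?_, rfl⟩
        rw [add_comm]
        exact mul_mem_wordBall (mem_wordBall_one hs) hw
      | inv_mul_cancel s hs g _ ih =>
        intro q hq
        obtain ⟨w, hw, hq'⟩ := ih q hq
        rw [mul_smul, ← hq']
        refine h ⟨s⁻¹ * w, ?_, rfl⟩
        rw [add_comm]
        exact mul_mem_wordBall (inv_mem_wordBall (mem_wordBall_one hs)) hw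
    refine Set.eq_univ_of_forall fun q => ?_
    obtain ⟨g, rfl⟩ := QuotientGroup.mk_surjective q
    have := key g (by rw [hS]; trivial) _ ⟨1, one_mem_wordBall n, rfl⟩
    simpa using this
  -- Until everything is covered, each increase of the radius gains a coset.
  have hcard : ∀ n, B n = Set.univ ∨ n + 1 ≤ (B n).ncard := by
    intro n
    induction n with
    | zero =>
      right
      exact (Set.ncard_pos (Set.toFinite _)).2 ⟨_, 1, one_mem_wordBall 0, rfl⟩
    | succ n ih =>
      rcases ih with h | h
      · exact Or.inl (Set.eq_univ_of_univ_subset (h ▸ hmono n))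
      · by_cases hsub : B (n + 1) ⊆ B n
        · exact Or.inl (Set.eq_univ_of_univ_subset (hfull n hsub ▸ hmono n))
        · right
          have := Set.ncard_lt_ncard (ssubset_of_subset_not_subset (hmono n) hsub)
            (Set.toFinite _)
          omega
  have huniv : B n = Set.univ := by
    rcases hcard n with h | h
    · exact h
    · have h2 : (B n).ncard ≤ H.index := by
        rw [Subgroup.index, ← Set.ncard_univ]
        exact Set.ncard_le_ncard (Set.subset_univ _)
      omega
  obtain ⟨w, hw, hq⟩ : ((g : G ⧸ H)) ∈ B n := by rw [huniv]; trivial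
  exact ⟨w, hw, w⁻¹ * g, QuotientGroup.eq.1 hq, by group⟩

end WordBall

/-! ### The cost of sections -/

/-- Every element of `A` is a product of an element of `W` and an element of `B`. -/
def Covers (W A B : Set (TreeAut Bool)) : Prop := ∀ a ∈ A, ∃ w ∈ W, ∃ b ∈ B, a = w * b

theorem Covers.mono {W A A' B B' : Set (TreeAut Bool)} (h : Covers W A B) (hA : A' ⊆ A)
    (hB : B ⊆ B') : Covers W A' B' := by
  intro a ha
  obtain ⟨w, hw, b, hb, e⟩ := h a (hA ha)
  exact ⟨w, hw, b, hB hb, e⟩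

/-- The coverings that a system of balls `W` satisfies are computed by adding radii. -/
structure IsBallSystem (W : ℕ → Set (TreeAut Bool)) : Prop where
  mul_mem : ∀ {m n : ℕ} {g h : TreeAut Bool}, g ∈ W m → h ∈ W n → g * h ∈ W (m + n)
  inv_mem : ∀ {n : ℕ} {g : TreeAut Bool}, g ∈ W n → g⁻¹ ∈ W n
  mono : ∀ {m n : ℕ}, m ≤ n → W m ⊆ W n

namespace IsBallSystem

variable {W : ℕ → Set (TreeAut Bool)}

theorem covers_trans (hW : IsBallSystem W) {m n : ℕ} {A B C : Set (TreeAut Bool)}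
    (h : Covers (W m) A B) (h' : Covers (W n) B C) : Covers (W (m + n)) A C := by
  intro a ha
  obtain ⟨w, hw, b, hb, rfl⟩ := h a ha
  obtain ⟨w', hw', c, hc, rfl⟩ := h' b hb
  exact ⟨_, hW.mul_mem hw hw', c, hc, (mul_assoc ..).symm⟩

theorem covers_of_commutatorApprox (hW : IsBallSystem W) {m n : ℕ}
    {X Y X' Y' C D : Set (TreeAut Bool)} (h : CommutatorApprox X Y X' Y' C D)
    (hX : Covers (W m) X Y) (hX' : Covers (W n) X' Y') : Covers (W (2 * m + 2 * n)) C D := by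
  intro c hc
  obtain ⟨g, hg, k, hk, H⟩ := h c hc
  obtain ⟨w, hw, e, he, rfl⟩ := hX g hg
  obtain ⟨w', hw', f, hf, rfl⟩ := hX' k hk
  obtain ⟨d, hd, rfl⟩ := H e he f hf
  refine ⟨_, ?_, d, hd, rfl⟩
  rw [mul_inv_cancel_right, mul_inv_cancel_right, commutatorElement_def]
  have := hW.mul_mem (hW.mul_mem (hW.mul_mem hw hw') (hW.inv_mem hw)) (hW.inv_mem hw')
  convert this using 2
  ring

/-- Each step down the chain replaces a length `r` by `2r + 2p`. Starting from `q`, four steps cost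
`2q + 2p`, `4q + 6p`, `8q + 14p` and `16q + 30p`. Their sum is the stated radius, since composing
these four coverings leads from `K_{m+2}` to `K_{m+3}`. -/
theorem covers_step (hW : IsBallSystem W) {m p q : ℕ}
    (h₀ : Covers (W p) (pairSet^[m] branchK) (pairSet^[m + 1] branchK))
    (h₁ : Covers (W q) (pairSet^[m + 1] branchK) (pairSet^[m + 2] branchK)) :
    Covers (W (30 * q + 52 * p)) (pairSet^[m + 2] branchK) (pairSet^[m + 3] branchK) := by
  have step : ∀ {k r : ℕ}, k < 4 →
      Covers (W r) (pairSet^[m] (pairSet (branchChain k)))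
        (pairSet^[m] (pairSet (branchChain (k + 1)))) →
      Covers (W (2 * r + 2 * p)) (pairSet^[m] (pairSet (branchChain (k + 1))))
        (pairSet^[m] (pairSet (branchChain (k + 2)))) := fun hk h =>
    hW.covers_of_commutatorApprox ((commutatorApprox_pairSet_branchChain hk).iterate m) h h₀
  have c0 : Covers (W q) (pairSet^[m] (pairSet (branchChain 0)))
      (pairSet^[m] (pairSet (branchChain (0 + 1)))) := by
    rw [zero_add, branchChain_one]
    exact h₁
  have c1 := step (by norm_num) c0
  have c2 := step (by norm_num) c1
  have c3 := step (by norm_num) c2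
  have c4 := step (by norm_num) c3
  have c := hW.covers_trans (hW.covers_trans (hW.covers_trans c1 c2) c3) c4
  rw [zero_add, branchChain_one] at c
  rw [show 30 * q + 52 * p = 2 * q + 2 * p + (2 * (2 * q + 2 * p) + 2 * p) +
    (2 * (2 * (2 * q + 2 * p) + 2 * p) + 2 * p) +
    (2 * (2 * (2 * (2 * q + 2 * p) + 2 * p) + 2 * p) + 2 * p) by ring]
  exact c.mono (subset_refl _)
    (pairSet_iterate_mono (pairSet_mono branchChain_five_subset) m)

theorem covers_pairSet_iterate (hW : IsBallSystem W) {L : ℕ}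
    (hL : Covers (W L) Grigorchuk branchK₂) (m : ℕ) :
    Covers (W (L * 35 ^ m)) (pairSet^[m] branchK) (pairSet^[m + 1] branchK) := by
  induction m using Nat.strong_induction_on with
  | _ m ih =>
    rcases m with _ | _ | m
    -- Words that cover modulo `K₂` serve both initial cases, `K` modulo `K₁` and `K₁` modulo `K₂`.
    · rw [pow_zero, mul_one]
      exact hL.mono branchK_le_Grigorchuk branchK₂_le_branchK₁
    · intro a ha
      obtain ⟨w, hw, b, hb, e⟩ := hL a (branchK_le_Grigorchuk (branchK₁_le_branchK ha))
      exact ⟨w, hW.mono (Nat.le_mul_of_pos_right _ (by positivity)) hw, b, hb, e⟩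
    · have h := hW.covers_step (ih m (by omega)) (ih (m + 1) (by omega))
      intro a ha
      obtain ⟨w, hw, b, hb, e⟩ := h a ha
      refine ⟨w, hW.mono ?_ hw, b, hb, e⟩
      -- What is left is `30·35 + 52 = 1102 ≤ 1225`.
      rw [show L * 35 ^ (m + 1) = 35 * (L * 35 ^ m) by ring,
        show L * 35 ^ (m + 1 + 1) = 1225 * (L * 35 ^ m) by ring]
      omega

theorem covers_Grigorchuk (hW : IsBallSystem W) {L : ℕ}
    (hL : Covers (W L) Grigorchuk branchK₂) (n : ℕ) :
    Covers (W (L * 35 ^ n)) Grigorchuk (pairSet^[n] branchK) := by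
  induction n with
  | zero =>
    rw [pow_zero, mul_one]
    exact hL.mono (subset_refl _) (branchK₂_le_branchK₁.trans branchK₁_le_branchK)
  | succ n ih =>
    intro a ha
    obtain ⟨w, hw, b, hb, e⟩ := hW.covers_trans ih (hW.covers_pairSet_iterate hL n) a ha
    refine ⟨w, hW.mono ?_ hw, b, hb, e⟩
    rw [show L * 35 ^ (n + 1) = 35 * (L * 35 ^ n) by ring]
    omega

end IsBallSystem

theorem pairSet_iterate_subset_levelStab (X : Set (TreeAut Bool)) (n : ℕ) :
    pairSet^[n] X ⊆ levelStab Bool n := by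
  induction n with
  | zero => simp [levelStab_zero]
  | succ n ih =>
    rw [Function.iterate_succ_apply']
    rintro _ ⟨u, hu, v, hv, rfl⟩
    exact pairAut_mem_levelStab_succ.2 ⟨ih hu, ih hv⟩

/-! ### Finite index -/

theorem index_subgroupOf_le_card {Γ : Type*} [Group Γ] {G H : Subgroup Γ} {F : Set Γ}
    (hF : F.Finite) (h : ∀ g ∈ G, ∃ f ∈ F, f⁻¹ * g ∈ H) :
    Finite (G ⧸ H.subgroupOf G) ∧ (H.subgroupOf G).index ≤ F.ncard := by
  choose φ hφ hφH using fun q : G ⧸ H.subgroupOf G => h q.out.1 q.out.2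
  have hinj : Function.Injective fun q => (⟨φ q, hφ q⟩ : F) := by
    intro q r hqr
    have e : φ q = φ r := congrArg Subtype.val hqr
    rw [← q.out_eq, ← r.out_eq]
    refine QuotientGroup.eq.2 (Subgroup.mem_subgroupOf.2 ?_)
    have := mul_mem (inv_mem (hφH q)) (e ▸ hφH r)
    simpa [mul_assoc] using this
  have := hF.to_subtype
  exact ⟨Finite.of_injective _ hinj, Nat.card_le_card_of_injective _ hinj⟩

theorem card_le_index_subgroupOf {Γ : Type*} [Group Γ] {G H : Subgroup Γ}
    [Finite (G ⧸ H.subgroupOf G)] {F : Finset Γ} (hF : ∀ f ∈ F, f ∈ G)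
    (h : ∀ f ∈ F, ∀ f' ∈ F, f⁻¹ * f' ∈ H → f = f') : F.card ≤ (H.subgroupOf G).index := by
  have hinj : Function.Injective
      fun f : F => ((⟨f.1, hF f.1 f.2⟩ : G) : G ⧸ H.subgroupOf G) := by
    intro f f' e
    exact Subtype.ext (h f.1 f.2 f'.1 f'.2 (Subgroup.mem_subgroupOf.1 (QuotientGroup.eq.1 e)))
  have := Nat.card_le_card_of_injective _ hinj
  rwa [Nat.card_eq_fintype_card, Fintype.card_coe] at this

theorem finite_covers_trans {F F' A B C : Set (TreeAut Bool)} (hF : F.Finite) (hF' : F'.Finite)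
    (h : Covers F A B) (h' : Covers F' B C) : ∃ F'' : Set (TreeAut Bool), F''.Finite ∧
      Covers F'' A C := by
  refine ⟨Set.image2 (· * ·) F F', hF.image2 _ hF', ?_⟩
  intro a ha
  obtain ⟨w, hw, b, hb, rfl⟩ := h a ha
  obtain ⟨w', hw', c, hc, rfl⟩ := h' b hb
  exact ⟨_, Set.mem_image2_of_mem hw hw', c, hc, (mul_assoc ..).symm⟩

theorem Covers.pair {F A B : Set (TreeAut Bool)} (h : Covers F A B) :
    Covers (pairSet F) (pairSet A) (pairSet B) := by
  rintro _ ⟨u, hu, v, hv, rfl⟩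
  obtain ⟨w, hw, b, hb, rfl⟩ := h u hu
  obtain ⟨w', hw', b', hb', rfl⟩ := h v hv
  exact ⟨_, ⟨w, hw, w', hw', rfl⟩, _, ⟨b, hb, b', hb', rfl⟩, (pairAut_mul ..).symm⟩

theorem finite_pairSet {F : Set (TreeAut Bool)} (hF : F.Finite) : (pairSet F).Finite := by
  refine (hF.image2 pairAut hF).subset ?_
  rintro _ ⟨u, hu, v, hv, rfl⟩
  exact ⟨u, hu, v, hv, rfl⟩

theorem finite_range_zpow {G : Type*} [Group G] {g : G} {n : ℕ} (hn : n ≠ 0) (hg : g ^ n = 1) :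
    (Set.range fun i : ℤ => g ^ i).Finite :=
  (isOfFinOrder_iff_pow_eq_one.2 ⟨n, Nat.pos_of_ne_zero hn, hg⟩).finite_zpowers

/-- Modulo `K`, `b` is central, because `⁅a, b⁆ = x` and `b` commutes with `d`. With `c = bd` and
`(da)⁴ = 1`, every element takes the form `bⁱ(da)ʲ` or `bⁱ(da)ʲa` modulo `K`. -/
theorem exists_finite_covers_branchK :
    ∃ F : Set (TreeAut Bool), F.Finite ∧ Covers F Grigorchuk branchK := by
  let P := Set.range fun i : ℤ => autB ^ i
  let R := Set.range fun j : ℤ => (autD * autA) ^ j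
  have hP : P.Finite := finite_range_zpow two_ne_zero (by rw [pow_two, autB_mul_self])
  have hR : R.Finite := finite_range_zpow four_ne_zero autD_mul_autA_pow_four
  refine ⟨Set.image2 (fun p w => p * w) P (Set.image2 (fun r c => r * c) R {1, autA}),
    hP.image2 _ (hR.image2 _ (Set.toFinite _)), ?_⟩
  let Φ : TreeAut Bool → Prop := fun g => ∃ i j : ℤ, ∃ c, (c = 1 ∨ c = autA) ∧
    ∃ k ∈ branchK, g = autB ^ i * ((autD * autA) ^ j * c) * k
  have hmove : ∀ k ∈ branchK, ∀ s ∈ Grigorchuk, s⁻¹ * k * s ∈ branchK := fun k hk s hs => by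
    simpa using conj_mem_branchK s⁻¹ (inv_mem hs) k hk
  have hA : ∀ g, Φ g → Φ (g * autA) := by
    rintro _ ⟨i, j, c, hc, k, hk, rfl⟩
    refine ⟨i, j, c * autA, ?_, _, hmove k hk _ autA_mem_Grigorchuk, by group⟩
    rcases hc with rfl | rfl
    · exact Or.inr (one_mul _)
    · exact Or.inl autA_mul_self
  have hD : ∀ g, Φ g → Φ (g * autD) := by
    rintro _ ⟨i, j, c, hc, k, hk, rfl⟩
    rcases hc with rfl | rfl
    · refine ⟨i, j + 1, autA, Or.inr rfl, _, hmove k hk _ autD_mem_Grigorchuk, ?_⟩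
      have e : autD = autD * autA * autA := by rw [mul_assoc, autA_mul_self, mul_one]
      rw [zpow_add_one, mul_assoc _ (autD * autA) autA, ← e]
      group
    · refine ⟨i, j - 1, 1, Or.inl rfl, _, hmove k hk _ autD_mem_Grigorchuk, ?_⟩
      have e : (autD * autA)⁻¹ = autA * autD := by rw [mul_inv_rev, autA_inv, autD_inv]
      rw [zpow_sub_one, e]
      group
  let Z := centralizerMod branchK conj_mem_branchK {autB}
  have hZA : autA ∈ Z := by
    refine ⟨autA_mem_Grigorchuk, ?_⟩
    rintro _ rfl
    rw [commutatorElement_def, autA_inv, autB_inv]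
    exact grigX_mem_branchK
  have hZD : autD ∈ Z := by
    refine ⟨autD_mem_Grigorchuk, ?_⟩
    rintro _ rfl
    rw [commutatorElement_def, autD_inv, autB_inv, autD_mul_autB, autC_mul_autD, autB_mul_self]
    exact one_mem _
  have hB : ∀ g, Φ g → Φ (g * autB) := by
    rintro _ ⟨i, j, c, hc, k, hk, rfl⟩
    have hcZ : c ∈ Z := by
      rcases hc with rfl | rfl
      exacts [one_mem _, hZA]
    have hw : (autD * autA) ^ j * c ∈ Z := mul_mem (zpow_mem (mul_mem hZD hZA) j) hcZ
    refine ⟨i + 1, j, c, hc, _, mul_mem ((inv_mem hw).2 autB rfl)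
      (hmove k hk _ autB_mem_Grigorchuk), ?_⟩
    rw [commutatorElement_def, zpow_add_one, autB_inv]
    generalize (autD * autA) ^ j * c = w
    have e : autB ^ i * autB * w * (w⁻¹ * autB * w⁻¹⁻¹ * autB * (autB * k * autB)) =
        autB ^ i * (autB * autB) * w * (autB * autB) * k * autB := by group
    rw [e, autB_mul_self, mul_one, mul_one]
  have hC : ∀ g, Φ g → Φ (g * autC) := by
    intro g hg
    rw [← autB_mul_autD, ← mul_assoc]
    exact hD _ (hB _ hg)
  have hs : ∀ s ∈ ({autA, autB, autC, autD} : Set (TreeAut Bool)), ∀ g, Φ g → Φ (g * s) := by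
    rintro s (rfl | rfl | rfl | rfl)
    exacts [hA, hB, hC, hD]
  intro g hg
  have hΦ : Φ g := by
    unfold Grigorchuk at hg
    induction hg using Subgroup.closure_induction_right with
    | one => exact ⟨0, 0, 1, Or.inl rfl, 1, one_mem _, by simp⟩
    | mul_right g _ s h ih => exact hs s h g ih
    | mul_inv_cancel g _ s h ih =>
      have e : s⁻¹ = s := by
        rcases h with rfl | rfl | rfl | rfl
        exacts [autA_inv, autB_inv, autC_inv, autD_inv]
      rw [e]
      exact hs s h g ih
  obtain ⟨i, j, c, hc, k, hk, rfl⟩ := hΦ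
  exact ⟨_, ⟨_, ⟨i, rfl⟩, _, ⟨_, ⟨j, rfl⟩, c, hc, rfl⟩, rfl⟩, k, hk, rfl⟩

theorem exists_finite_covers_branchK₁ :
    ∃ F : Set (TreeAut Bool), F.Finite ∧ Covers F branchK branchK₁ := by
  refine ⟨(fun i : ℤ => grigX ^ i) '' Set.Ico 0 4, (Set.finite_Ico 0 4).image _, ?_⟩
  intro k hk
  obtain ⟨i, hi⟩ := exists_hasDegree hk
  refine ⟨_, ⟨i % 4, ⟨Int.emod_nonneg _ (by norm_num), Int.emod_lt_of_pos _ (by norm_num)⟩, rfl⟩,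
    grigX ^ (-(i % 4)) * k, ?_, by simp⟩
  have h := (hasDegree_grigX_zpow (-(i % 4))).mul hi
  exact h.mem_branchK₁ (by omega)

theorem finiteIndex_branchK₂ : (branchK₂.subgroupOf Grigorchuk).FiniteIndex := by
  obtain ⟨F₀, hF₀, h₀⟩ := exists_finite_covers_branchK
  obtain ⟨F₁, hF₁, h₁⟩ := exists_finite_covers_branchK₁
  obtain ⟨F₂, hF₂, h₂⟩ := finite_covers_trans hF₀ hF₁ h₀ h₁
  obtain ⟨F, hF, h⟩ := finite_covers_trans hF₂ (finite_pairSet hF₁) h₂ h₁.pair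
  have := (index_subgroupOf_le_card (G := Grigorchuk) (H := branchK₂) hF fun g hg => by
    obtain ⟨f, hf, k, hk, rfl⟩ := h g hg
    exact ⟨f, hf, by rwa [inv_mul_cancel_left]⟩).1
  exact Subgroup.finiteIndex_of_finite_quotient

/-! ### The index of the level stabilisers -/

/-- Passing down a level squares the number of representatives and doubles it for the swap `a`. The
factor `2` makes `2 * F.card` at most square each time, so the induction closes. -/
theorem exists_finset_covers_levelStab (n : ℕ) : ∃ F : Finset (TreeAut Bool),
    2 * F.card ≤ 2 ^ 2 ^ n ∧ ∀ g ∈ Grigorchuk, ∃ f ∈ F, f⁻¹ * g ∈ levelStab Bool n := by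
  classical
  induction n with
  | zero => exact ⟨{1}, by simp, fun g _ => ⟨1, by simp, by simp [levelStab_zero]⟩⟩
  | succ n ih =>
    obtain ⟨F, hF, h⟩ := ih
    let F₁ := (F ×ˢ F).image fun p => pairAut p.1 p.2
    have h1 : F₁.card ≤ F.card * F.card := by
      rw [← Finset.card_product]
      exact Finset.card_image_le
    have h2 : (F₁.image fun f => autA * f).card ≤ F₁.card := Finset.card_image_le
    have key : ∀ u ∈ Grigorchuk, ∀ v ∈ Grigorchuk, ∃ f ∈ F₁,
        f⁻¹ * pairAut u v ∈ levelStab Bool (n + 1) := by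
      intro u hu v hv
      obtain ⟨f, hf, hfu⟩ := h u hu
      obtain ⟨f', hf', hfv⟩ := h v hv
      refine ⟨pairAut f f', Finset.mem_image.2 ⟨(f, f'), Finset.mk_mem_product hf hf', rfl⟩, ?_⟩
      rw [pairAut_inv, pairAut_mul]
      exact pairAut_mem_levelStab_succ.2 ⟨hfu, hfv⟩
    refine ⟨F₁ ∪ F₁.image fun f => autA * f, ?_, ?_⟩
    · have h3 := Finset.card_union_le F₁ (F₁.image fun f => autA * f)
      have h4 := Nat.mul_le_mul hF hF
      rw [pow_succ 2 n, pow_mul, pow_two]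
      nlinarith
    · intro g hg
      obtain ⟨u, hu, v, hv, rfl | rfl⟩ := exists_pairAut_of_mem_Grigorchuk hg
      · obtain ⟨f, hf, hfg⟩ := key u hu v hv
        exact ⟨f, Finset.mem_union_left _ hf, hfg⟩
      · obtain ⟨f, hf, hfg⟩ := key u hu v hv
        refine ⟨autA * f, Finset.mem_union_right _ (Finset.mem_image_of_mem _ hf), ?_⟩
        rwa [mul_inv_rev, mul_assoc, inv_mul_cancel_left]

theorem finite_quotient_grigStab (n : ℕ) : Finite (Grigorchuk ⧸ grigStab n) := by
  obtain ⟨F, -, h⟩ := exists_finset_covers_levelStab n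
  exact (index_subgroupOf_le_card F.finite_toSet h).1

theorem index_grigStab_le (n : ℕ) : (grigStab n).index ≤ 2 ^ 2 ^ n := by
  obtain ⟨F, hF, h⟩ := exists_finset_covers_levelStab n
  have h1 : (grigStab n).index ≤ _ := (index_subgroupOf_le_card F.finite_toSet h).2
  rw [Set.ncard_coe_finset] at h1
  omega

theorem grigX_notMem_levelStab_two : grigX ∉ levelStab Bool 2 := by
  intro h
  have := h [false, false] rfl
  revert this
  decide

/-- Since `K × K ≤ K`, forming pairs squares the number of elements of `K` that one further level
separates. The start is `{1, x}`, with `x` visible at level `2`. -/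
theorem exists_finset_branchK (m : ℕ) : ∃ F : Finset (TreeAut Bool), F.card = 2 ^ 2 ^ m ∧
    (∀ f ∈ F, f ∈ branchK) ∧
    ∀ f ∈ F, ∀ f' ∈ F, f⁻¹ * f' ∈ levelStab Bool (m + 2) → f = f' := by
  classical
  induction m with
  | zero =>
    have hx := grigX_notMem_levelStab_two
    have hne : (1 : TreeAut Bool) ≠ grigX := fun h => hx (h ▸ one_mem _)
    refine ⟨{1, grigX}, by rw [Finset.card_pair hne]; rfl, ?_, ?_⟩
    · simp [one_mem, grigX_mem_branchK]
    · intro f hf f' hf' h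
      simp only [Finset.mem_insert, Finset.mem_singleton] at hf hf'
      rcases hf with rfl | rfl <;> rcases hf' with rfl | rfl
      · rfl
      · rw [inv_one, one_mul] at h
        exact absurd h hx
      · rw [mul_one, inv_mem_iff] at h
        exact absurd h hx
      · rfl
  | succ m ih =>
    obtain ⟨F, hF, hK, h⟩ := ih
    refine ⟨(F ×ˢ F).image fun p => pairAut p.1 p.2, ?_, ?_, ?_⟩
    · rw [Finset.card_image_of_injective, Finset.card_product, hF, pow_succ 2 m, pow_mul, pow_two]
      rintro ⟨u, v⟩ ⟨u', v'⟩ e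
      obtain ⟨rfl, rfl⟩ := pairAut_injective e
      rfl
    · intro f hf
      obtain ⟨⟨u, v⟩, huv, rfl⟩ := Finset.mem_image.1 hf
      rw [Finset.mem_product] at huv
      exact branchK₁_le_branchK (pairAut_mem_pairSubgroup (hK u huv.1) (hK v huv.2))
    · intro f hf f' hf' hff
      obtain ⟨⟨u, v⟩, huv, rfl⟩ := Finset.mem_image.1 hf
      obtain ⟨⟨u', v'⟩, huv', rfl⟩ := Finset.mem_image.1 hf'
      rw [Finset.mem_product] at huv huv'
      rw [pairAut_inv, pairAut_mul, show m + 1 + 2 = m + 2 + 1 from rfl,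
        pairAut_mem_levelStab_succ] at hff
      dsimp only at huv huv' ⊢
      rw [h u huv.1 u' huv'.1 hff.1, h v huv.2 v' huv'.2 hff.2]

theorem le_index_grigStab (m : ℕ) : 2 ^ 2 ^ m ≤ (grigStab (m + 2)).index := by
  obtain ⟨F, hF, hK, h⟩ := exists_finset_branchK m
  have : Finite (Grigorchuk ⧸ (levelStab Bool (m + 2)).subgroupOf Grigorchuk) :=
    finite_quotient_grigStab (m + 2)
  rw [← hF]
  exact card_le_index_subgroupOf (fun f hf => branchK_le_Grigorchuk (hK f hf)) h

theorem two_le_index_grigStab_one : 2 ≤ (grigStab 1).index := by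
  classical
  have hx : autA ∉ levelStab Bool 1 := by
    intro h
    have := h [false] rfl
    revert this
    decide
  have : Finite (Grigorchuk ⧸ (levelStab Bool 1).subgroupOf Grigorchuk) :=
    finite_quotient_grigStab 1
  have h0 : (grigStab 1).index ≠ 0 := Subgroup.index_ne_zero_iff_finite.2 this
  have h1 : (grigStab 1).index ≠ 1 := by
    rw [Ne, Subgroup.index_eq_one]
    intro h
    have hm : (⟨autA, autA_mem_Grigorchuk⟩ : Grigorchuk) ∈ grigStab 1 := by rw [h]; trivial
    exact hx (Subgroup.mem_subgroupOf.1 hm)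
  omega

/-- `2ⁿ log 2 / 4 ≤ log |G : Stab(n)| ≤ 2ⁿ log 2` for `n ≥ 1`. -/
theorem log_index_grigStab_bounds {n : ℕ} (hn : 1 ≤ n) :
    Real.log 2 / 4 * 2 ^ n ≤ Real.log (grigStab n).index ∧
      Real.log (grigStab n).index ≤ Real.log 2 * 2 ^ n := by
  have hlow : ∀ k l : ℕ, 2 ^ k ≤ l → k * Real.log 2 ≤ Real.log l := by
    intro k l h
    rw [← Real.log_pow]
    exact Real.log_le_log (by positivity) (by exact_mod_cast h)
  have hl2 : 0 < Real.log 2 := Real.log_pos one_lt_two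
  constructor
  -- The factor `1/4` pays for the two levels needed to see `x`; level `1` is handled by `a`.
  · obtain _ | _ | m := n
    · omega
    · have := hlow 1 _ two_le_index_grigStab_one
      push_cast at this
      norm_num
      linarith
    · have := hlow _ _ (le_index_grigStab m)
      push_cast at this
      rw [show m + 1 + 1 = m + 2 from rfl, pow_add]
      linarith
  · have h0 : (grigStab n).index ≠ 0 :=
      Subgroup.index_ne_zero_iff_finite.2 (finite_quotient_grigStab n)
    have h1 : Real.log (grigStab n).index ≤ Real.log ((2 ^ 2 ^ n : ℕ) : ℝ) :=
      Real.log_le_log (by exact_mod_cast Nat.pos_of_ne_zero h0)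
        (by exact_mod_cast index_grigStab_le n)
    have h2 : Real.log ((2 ^ 2 ^ n : ℕ) : ℝ) = Real.log 2 * 2 ^ n := by
      push_cast
      rw [Real.log_pow]
      push_cast
      ring
    linarith

/-! ### The diameter bound -/

theorem groupDiam_quotient_grigStab_le (n : ℕ) :
    groupDiam (Grigorchuk ⧸ grigStab n) ≤
      (branchK₂.subgroupOf Grigorchuk).index * 35 ^ n := by
  refine groupDiam_le fun S hS => ?_
  let L := (branchK₂.subgroupOf Grigorchuk).index
  -- The balls of the quotient are pulled back to tree automorphisms, so that the covering argument
  -- runs there while lengths are measured in the quotient.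
  let W : ℕ → Set (TreeAut Bool) := fun l =>
    {g | ∃ hg : g ∈ Grigorchuk, ((⟨g, hg⟩ : Grigorchuk) : Grigorchuk ⧸ grigStab n) ∈ wordBall S l}
  have hW : IsBallSystem W :=
    { mul_mem := fun ⟨hg, hg'⟩ ⟨hh, hh'⟩ => ⟨mul_mem hg hh, mul_mem_wordBall hg' hh'⟩
      inv_mem := fun ⟨hg, hg'⟩ => ⟨inv_mem hg, inv_mem_wordBall hg'⟩
      mono := fun h _ ⟨hg, hg'⟩ => ⟨hg, wordBall_mono h hg'⟩ }
  have hL0 : L ≠ 0 := finiteIndex_branchK₂.index_ne_zero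
  have hL : Covers (W L) Grigorchuk branchK₂ := by
    let H := (branchK₂.subgroupOf Grigorchuk).map (QuotientGroup.mk' (grigStab n))
    -- The image of `K₂` in the quotient has index dividing `L`, so the radius `L` suffices for
    -- every `n` and `S`.
    have hdvd : H.index ∣ L :=
      Subgroup.index_map_dvd _ (QuotientGroup.mk'_surjective (grigStab n))
    have : H.FiniteIndex := ⟨fun h => hL0 (Nat.eq_zero_of_zero_dvd (h ▸ hdvd))⟩
    intro g hg
    obtain ⟨w, hw, _, ⟨k, hk, rfl⟩, e⟩ := exists_wordBall_mul_mem hS H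
      (Nat.le_of_dvd (Nat.pos_of_ne_zero hL0) hdvd) ((⟨g, hg⟩ : Grigorchuk) : _ ⧸ grigStab n)
    refine ⟨g * k.1⁻¹, ⟨mul_mem hg (inv_mem k.2), ?_⟩, k.1, hk, by group⟩
    have e' : w = ((⟨g * k.1⁻¹, mul_mem hg (inv_mem k.2)⟩ : Grigorchuk) : _ ⧸ grigStab n) :=
      (eq_mul_inv_of_mul_eq e.symm)
    rwa [← e']
  refine Set.eq_univ_of_forall fun q => ?_
  obtain ⟨⟨g, hg⟩, rfl⟩ := QuotientGroup.mk_surjective q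
  obtain ⟨w, ⟨hw, hw'⟩, b, hb, e⟩ := hW.covers_Grigorchuk hL n g hg
  have e' : ((⟨g, hg⟩ : Grigorchuk) : Grigorchuk ⧸ grigStab n) = (⟨w, hw⟩ : Grigorchuk) := by
    refine (QuotientGroup.eq.2 (Subgroup.mem_subgroupOf.2 ?_)).symm
    change w⁻¹ * g ∈ levelStab Bool n
    rw [e, inv_mul_cancel_left]
    exact pairSet_iterate_subset_levelStab _ n hb
  rw [e']
  exact hw'

theorem groupDiam_quotient_grigStab_zero : groupDiam (Grigorchuk ⧸ grigStab 0) = 0 := by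
  have htop : grigStab 0 = ⊤ := by
    rw [grigStab, levelStab_zero, Subgroup.top_subgroupOf]
  have hsub : Subsingleton (Grigorchuk ⧸ grigStab 0) := by
    rw [htop]
    exact QuotientGroup.subsingleton_quotient_top
  refine Nat.le_zero.1 (groupDiam_le fun S _ => Set.eq_univ_of_forall fun q => ?_)
  rw [Subsingleton.elim q 1]
  exact one_mem_wordBall 0

theorem mainTheorem2 :
    (∀ n : ℕ, Finite (Grigorchuk ⧸ grigStab n)) ∧
    (∃ C : ℝ, ∀ n : ℕ, (groupDiam (Grigorchuk ⧸ grigStab n) : ℝ) ≤ C * (35 : ℝ) ^ n) ∧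
    (∃ C : ℝ, ∀ n : ℕ, (groupDiam (Grigorchuk ⧸ grigStab n) : ℝ) ≤
      C * Real.log ((grigStab n).index : ℝ) ^ (Real.log 35 / Real.log 2)) ∧
    (∃ c C : ℝ, 0 < c ∧ 0 < C ∧ ∀ n : ℕ, 1 ≤ n →
      c * (35 : ℝ) ^ n ≤ Real.log ((grigStab n).index : ℝ) ^ (Real.log 35 / Real.log 2) ∧
      Real.log ((grigStab n).index : ℝ) ^ (Real.log 35 / Real.log 2) ≤ C * (35 : ℝ) ^ n) := by
  have hdiam : ∀ n : ℕ, (groupDiam (Grigorchuk ⧸ grigStab n) : ℝ) ≤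
      (branchK₂.subgroupOf Grigorchuk).index * (35 : ℝ) ^ n := fun n => by
    exact_mod_cast groupDiam_quotient_grigStab_le n
  have hl2 : 0 < Real.log 2 := Real.log_pos one_lt_two
  have hs : 0 < Real.log 35 / Real.log 2 := div_pos (Real.log_pos (by norm_num)) hl2
  have hpow : ∀ (r : ℝ) (n : ℕ), 0 ≤ r →
      (r * 2 ^ n) ^ (Real.log 35 / Real.log 2) = r ^ (Real.log 35 / Real.log 2) * 35 ^ n := by
    intro r n hr
    have h2 : (2 : ℝ) ^ (Real.log 35 / Real.log 2) = 35 := by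
      rw [Real.rpow_def_of_pos two_pos, mul_div_cancel₀ _ hl2.ne', Real.exp_log (by norm_num)]
    rw [Real.mul_rpow hr (by positivity), ← Real.rpow_natCast_mul two_pos.le, mul_comm (n : ℝ),
      Real.rpow_mul_natCast two_pos.le, h2]
  have hbounds : ∀ n : ℕ, 1 ≤ n →
      (Real.log 2 / 4) ^ (Real.log 35 / Real.log 2) * (35 : ℝ) ^ n ≤
        Real.log ((grigStab n).index : ℝ) ^ (Real.log 35 / Real.log 2) ∧
      Real.log ((grigStab n).index : ℝ) ^ (Real.log 35 / Real.log 2) ≤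
        Real.log 2 ^ (Real.log 35 / Real.log 2) * (35 : ℝ) ^ n := by
    intro n hn
    obtain ⟨h1, h2⟩ := log_index_grigStab_bounds hn
    rw [← hpow _ n (by positivity), ← hpow _ n (by positivity)]
    exact ⟨Real.rpow_le_rpow (by positivity) h1 hs.le,
      Real.rpow_le_rpow (le_trans (by positivity) h1) h2 hs.le⟩
  have hc : 0 < (Real.log 2 / 4) ^ (Real.log 35 / Real.log 2) := by positivity
  refine ⟨finite_quotient_grigStab, ⟨_, hdiam⟩,
    ⟨(branchK₂.subgroupOf Grigorchuk).index / (Real.log 2 / 4) ^ (Real.log 35 / Real.log 2),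
      fun n => ?_⟩, ⟨_, _, hc, by positivity, hbounds⟩⟩
  -- At `n = 0` the logarithm vanishes and no constant can help; the bound holds because the trivial
  -- group has diameter `0`.
  rcases Nat.eq_zero_or_pos n with rfl | hn
  · rw [groupDiam_quotient_grigStab_zero, Nat.cast_zero]
    exact mul_nonneg (by positivity) (Real.rpow_nonneg (Real.log_natCast_nonneg _) _)
  · refine (hdiam n).trans ?_
    rw [div_mul_eq_mul_div, le_div_iff₀ hc, mul_assoc, mul_comm _ (_ ^ (_ : ℝ))]
    exact mul_le_mul_of_nonneg_left (hbounds n hn).1 (by positivity)
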